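/- Let $S$ and $S'$ be closed (compact, connected, without boundary) oriented surfaces, let $f:S\to S$ and $g:S'\to S'$ be generalized pseudo-Anosov homeomorphisms with stable and unstable measured foliations $(\mathcal F^s,\mathcal F^u)$ and $(\mathcal G^s,\mathcal G^u)$ respectively (finitely many $k$-prong singularities, $k=1$ or $k\ge 3$, are allowed; a leaf through a singularity contains all its prongs). Thus $f$ preserves the orientation and leaves invariant two transverse singular measured foliations $(\mathcal F^s,\mu^s)$, $(\mathcal F^u,\mu^u)$ with the same singularities of the same types, with $f_*\mu^u=\lambda\mu^u$ and $f_*\mu^s=\lambda^{-1}\mu^s$ for some $\lambda>1$, and likewise for $g$. Let $h:S\to S'$ be an orientation-preserving homeomorphism with $g=h\circ f\circ h^{-1}$. A \emph{rectangle} is a compact set $R$ with a parametrization $r:[0,1]^2\to R$: a continuous surjection which is an orientation-preserving homeomorphism of the open square onto its image $\mathring R$ (the interior of $R$) and which embeds every horizontal (vertical) segment of the square into a single stable (unstable) leaf. It is \emph{geometrized} by choosing an orientation of the vertical segments of the square; the horizontal segments get the orientation which, followed by the vertical one, gives the standard orientation of the plane, and both are carried to $R$ by $r$. A \emph{geometric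 Markov partition} for $f$ is a finite family $\mathcal R=\{R_i\}_{i=1}^n$ of geometrized rectangles which cover $S$, have pairwise disjoint interiors, and are such that for all $i,k$ the closure of each nonempty connected component of $\mathring R_i\cap f^{-1}(\mathring R_k)$ is a horizontal subrectangle of $R_i$, and the closure of each nonempty connected component of $f(\mathring R_i)\cap\mathring R_k$ is a vertical subrectangle of $R_k$. (A horizontal, respectively vertical, subrectangle of $R$ is a rectangle contained in $R$ whose horizontal, respectively vertical, leaves through its interior points are leaves of $R$.) Label the horizontal subrectangles so obtained in $R_i$ from bottom to top as $H^i_1,\dots,H^i_{h_i}$, and the vertical ones in $R_k$ from left to right as $V^k_1,\dots,V^k_{v_k}$. The \emph{geometric type} of $(f,\mathcal R)$ is $\mathcal T(f,\mathcal R)=(n,\{(h_i,v_i)\}_{i=1}^n,\rho,\epsilon)$, where $\rho$ is the bijection of labels with $\rho(i,j)=(k,l)$ if and only if $f(H^i_j)=V^k_l$, and $\epsilon(i,j)=1$ if the image under $f$ of the vertical direction of $H^i_j$ is the vertical direction of $V^k_l$, and $\epsilon(i,j)=-1$ otherwise. Let $\mathcal R=\{R_i\}_{i=1}^n$ be a geometric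 Markov partition for $f$, and let $h(\mathcal R)=\{h(R_i)\}_{i=1}^n$, where $h(R_i)$ is parametrized by $h\circ r_i$, with $r_i$ the parametrization of $R_i$, and carries the image under $h$ of the vertical direction of $R_i$. Then $h(\mathcal R)$ is a geometric Markov partition for $g$ (with respect to $\mathcal G^s,\mathcal G^u$), the geometric types of $(f,\mathcal R)$ and $(g,h(\mathcal R))$ are well defined, and $\mathcal T(g,h(\mathcal R))=\mathcal T(f,\mathcal R)$. -/

import Mathlib

open Set Filter Topology
open scoped ENNReal NNReal

/-! ### Oriented topological surfaces -/

/-- A map `φ` between open pieces of the plane preserves the orientation at `z`: for every small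
`r > 0` the loop `t ↦ φ (z + r e^{it})` avoids `φ z` and has winding number `+1` around it. The
winding number is read off from a continuous logarithm `L` of `φ (z + r e^{it}) - φ z`. For a local
homeomorphism this is the condition that the local degree at `z` equals `+1`. -/
def PreservesOrientationAt (φ : ℂ → ℂ) (z : ℂ) : Prop :=
  ∀ᶠ r : ℝ in 𝓝[>] 0, ∃ L : ℝ → ℂ, Continuous L ∧
    (∀ t : ℝ, φ (z + r * Complex.exp (t * Complex.I)) - φ z = Complex.exp (L t)) ∧
    L (2 * Real.pi) = L 0 + 2 * Real.pi * Complex.I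

/-- An oriented surface without boundary: an atlas of charts with values in `ℂ` whose transition
maps preserve the orientation of `ℂ`. -/
class OrientedSurface (S : Type*) [TopologicalSpace S] extends ChartedSpace ℂ S where
  oriented : ∀ e ∈ atlas, ∀ e' ∈ atlas, ∀ x ∈ e.source ∩ e'.source,
    PreservesOrientationAt (fun z => e' (e.symm z)) (e x)

/-- A homeomorphism between oriented surfaces preserves the orientation. -/
def OrientationPreserving {S S' : Type*} [TopologicalSpace S] [OrientedSurface S]
    [TopologicalSpace S'] [OrientedSurface S'] (h : S ≃ₜ S') : Prop :=
  ∀ e ∈ atlas ℂ S, ∀ e' ∈ atlas ℂ S', ∀ x ∈ e.source, h x ∈ e'.source →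
    PreservesOrientationAt (fun z => e' (h (e.symm z))) (e x)

/-! ### Singular measured foliations -/

/-- `|Im (z ^ (k / 2))|`: its level sets in `ℂ` are the leaves of the standard horizontal foliation
with a `k`-prong at `0`, and its variation along a path is the standard transverse measure. -/
noncomputable def prongHeight (k : ℕ) (z : ℂ) : ℝ := Real.sqrt ((‖z‖ ^ k - (z ^ k).re) / 2)

/-- `|Re (z ^ (k / 2))|`: the same for the standard vertical foliation with a `k`-prong at `0`. -/
noncomputable def prongWidth (k : ℕ) (z : ℂ) : ℝ := Real.sqrt ((‖z‖ ^ k + (z ^ k).re) / 2)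

/-- The total variation of a function along a path. -/
noncomputable def pathVariation {S : Type*} [TopologicalSpace S] {x y : S} (u : S → ℝ)
    (γ : Path x y) : ℝ≥0∞ :=
  eVariationOn (fun t => u (γ t)) univ

/-- A measured foliation with finitely many prong singularities, where `k`-prongs with
`k = 1` and `k ≥ 3` are allowed. A regular point is a point with `2` prongs. `measure γ` is the
total transverse measure `∫_γ dμ` of a path `γ`. Near every point the foliation is, in a suitable
chart, the standard one. -/
structure MeasuredFoliation (S : Type*) [TopologicalSpace S] where
  prongs : S → ℕ
  one_le_prongs : ∀ p, 1 ≤ prongs p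
  finite_singular : {p | prongs p ≠ 2}.Finite
  measure : ∀ {x y : S}, Path x y → ℝ≥0∞
  measure_trans : ∀ {x y z : S} (γ : Path x y) (δ : Path y z),
    measure (γ.trans δ) = measure γ + measure δ
  exists_chart : ∀ p, ∃ φ : OpenPartialHomeomorph S ℂ, p ∈ φ.source ∧ φ p = 0 ∧
    ∀ {x y : S} (γ : Path x y), range γ ⊆ φ.source →
      measure γ = pathVariation (fun q => prongHeight (prongs p) (φ q)) γ

/-- The leaf through `x`: all points which can be reached from `x` by a path of zero transverse
measure, that is, by a path running through a chain of plaques. The leaf of a singularity contains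
the singularity and all its prongs. -/
def MeasuredFoliation.leaf {S : Type*} [TopologicalSpace S] (F : MeasuredFoliation S) (x : S) :
    Set S :=
  {y | ∃ γ : Path x y, F.measure γ = 0}

/-- Two measured foliations are transverse, with the same singularities of the same types: near
every point there is a chart in which the first one is the standard horizontal and the second one
the standard vertical measured foliation. -/
def MeasuredFoliation.Transverse {S : Type*} [TopologicalSpace S]
    (F G : MeasuredFoliation S) : Prop :=
  F.prongs = G.prongs ∧
  ∀ p, ∃ φ : OpenPartialHomeomorph S ℂ, p ∈ φ.source ∧ φ p = 0 ∧
    ∀ {x y : S} (γ : Path x y), range γ ⊆ φ.source →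
      F.measure γ = pathVariation (fun q => prongHeight (F.prongs p) (φ q)) γ ∧
      G.measure γ = pathVariation (fun q => prongWidth (F.prongs p) (φ q)) γ

/-- `f` maps the foliation `F` to itself, and `f_* μ = c μ` for its transverse measure `μ`, where
`(f_* μ)(γ) = μ (f⁻¹ ∘ γ)`. -/
def MeasuredFoliation.IsScaledBy {S : Type*} [TopologicalSpace S] (F : MeasuredFoliation S)
    (f : S ≃ₜ S) (c : ℝ≥0) : Prop :=
  (∀ p, F.prongs (f p) = F.prongs p) ∧
  ∀ {x y : S} (γ : Path x y), F.measure (γ.map f.symm.continuous) = c * F.measure γ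

/-- `f` is a generalized pseudo-Anosov homeomorphism with stable foliation `Fs` and unstable
foliation `Fu`. -/
def IsPseudoAnosov {S : Type*} [TopologicalSpace S] [OrientedSurface S] (f : S ≃ₜ S)
    (Fs Fu : MeasuredFoliation S) : Prop :=
  OrientationPreserving f ∧ Fs.Transverse Fu ∧
  ∃ c : ℝ≥0, 1 < c ∧ Fu.IsScaledBy f c ∧ Fs.IsScaledBy f c⁻¹

/-! ### Rectangles -/

/-- The closed unit square. -/
def closedSquare : Set (ℝ × ℝ) := Icc 0 1 ×ˢ Icc 0 1

/-- The open unit square. -/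
def openSquare : Set (ℝ × ℝ) := Ioo 0 1 ×ˢ Ioo 0 1

/-- The horizontal segment at height `t` of the closed square. -/
def hSegment (t : ℝ) : Set (ℝ × ℝ) := Icc 0 1 ×ˢ {t}

/-- The vertical segment at abscissa `s` of the closed square. -/
def vSegment (s : ℝ) : Set (ℝ × ℝ) := {s} ×ˢ Icc 0 1

/-- `ρ`, restricted to the closed unit square, is a parametrization of the rectangle `R` adapted to
the stable foliation `Fs` and the unstable foliation `Fu`. (The values of `ρ` off the closed square
play no role; the image of the open square is open in the surface by invariance of domain.) -/
structure IsParametrization {S : Type*} [TopologicalSpace S] [OrientedSurface S]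
    (Fs Fu : MeasuredFoliation S) (ρ : ℝ × ℝ → S) (R : Set S) : Prop where
  continuousOn : ContinuousOn ρ closedSquare
  image_eq : ρ '' closedSquare = R
  isOpenEmbedding : IsOpenEmbedding (openSquare.domRestrict ρ)
  orientation : ∀ z : ℂ, (z.re, z.im) ∈ openSquare → ∀ e ∈ atlas ℂ S,
    ρ (z.re, z.im) ∈ e.source → PreservesOrientationAt (fun w => e (ρ (w.re, w.im))) z
  horizontal : ∀ t ∈ Icc (0 : ℝ) 1,
    (∃ x, ρ '' hSegment t ⊆ Fs.leaf x) ∧ IsEmbedding ((hSegment t).domRestrict ρ)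
  vertical : ∀ s ∈ Icc (0 : ℝ) 1,
    (∃ x, ρ '' vSegment s ⊆ Fu.leaf x) ∧ IsEmbedding ((vSegment s).domRestrict ρ)

/-- The data of a geometrized rectangle: a map `param` parametrizing it and an orientation `dir` of
the vertical leaves of the unit square (`1` is upward, `-1` is downward). Via `param` it orients the
vertical leaves of the rectangle. The horizontal leaves of the square are oriented so that
horizontal followed by vertical is the standard orientation of the plane: rightward if `dir = 1`,
leftward if `dir = -1`. -/
structure GeometricRectangle (S : Type*) where
  param : ℝ × ℝ → S
  dir : ℤˣ

namespace GeometricRectangle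

variable {S : Type*}

/-- The rectangle as a subset of the surface. -/
def carrier (R : GeometricRectangle S) : Set S := R.param '' closedSquare

/-- The interior of the rectangle. -/
def inner (R : GeometricRectangle S) : Set S := R.param '' openSquare

/-- The vertical coordinate, increasing along the chosen vertical direction. -/
def vCoord (R : GeometricRectangle S) (p : ℝ × ℝ) : ℝ := ((R.dir : ℤ) : ℝ) * p.2

/-- The horizontal coordinate, increasing along the induced horizontal direction. -/
def hCoord (R : GeometricRectangle S) (p : ℝ × ℝ) : ℝ := ((R.dir : ℤ) : ℝ) * p.1

/-- The image of a geometrized rectangle under a map `h`, with the pushed forward directions. -/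
def map {S' : Type*} (h : S → S') (R : GeometricRectangle S) : GeometricRectangle S' where
  param := fun p => h (R.param p)
  dir := R.dir

/-- `H` lies below `H'` in `R`, for the vertical direction of `R`. -/
def Below (R : GeometricRectangle S) (H H' : Set S) : Prop :=
  ∀ p ∈ openSquare, ∀ p' ∈ openSquare, R.param p ∈ H → R.param p' ∈ H' → R.vCoord p ≤ R.vCoord p'

/-- `V` lies to the left of `V'` in `R`, for the horizontal direction of `R`. -/
def LeftOf (R : GeometricRectangle S) (V V' : Set S) : Prop :=
  ∀ p ∈ openSquare, ∀ p' ∈ openSquare, R.param p ∈ V → R.param p' ∈ V' → R.hCoord p ≤ R.hCoord p'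

end GeometricRectangle

/-- `H` is a horizontal subrectangle of `R`: a rectangle contained in `R` whose horizontal leaf
through any of its interior points is a horizontal leaf of `R`. -/
def IsHorizontalSubrectangle {S : Type*} [TopologicalSpace S] [OrientedSurface S]
    (Fs Fu : MeasuredFoliation S) (R : GeometricRectangle S) (H : Set S) : Prop :=
  H ⊆ R.carrier ∧ ∃ ρ, IsParametrization Fs Fu ρ H ∧
    ∀ t ∈ Ioo (0 : ℝ) 1, ∃ t' ∈ Icc (0 : ℝ) 1, ρ '' hSegment t = R.param '' hSegment t'

/-- `V` is a vertical subrectangle of `R`. -/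
def IsVerticalSubrectangle {S : Type*} [TopologicalSpace S] [OrientedSurface S]
    (Fs Fu : MeasuredFoliation S) (R : GeometricRectangle S) (V : Set S) : Prop :=
  V ⊆ R.carrier ∧ ∃ ρ, IsParametrization Fs Fu ρ V ∧
    ∀ s ∈ Ioo (0 : ℝ) 1, ∃ s' ∈ Icc (0 : ℝ) 1, ρ '' vSegment s = R.param '' vSegment s'

/-! ### Geometric Markov partitions -/

/-- The closures of the nonempty connected components of a set `W`. -/
def componentClosures {S : Type*} [TopologicalSpace S] (W : Set S) : Set (Set S) :=
  {C | ∃ x ∈ W, C = closure (connectedComponentIn W x)}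

/-- The horizontal subrectangles of the family `R` contained in `R i`. -/
def horizontalSubrectangles {S : Type*} [TopologicalSpace S] (f : S ≃ₜ S) {n : ℕ}
    (R : Fin n → GeometricRectangle S) (i : Fin n) : Set (Set S) :=
  ⋃ k, componentClosures ((R i).inner ∩ f ⁻¹' (R k).inner)

/-- The vertical subrectangles of the family `R` contained in `R k`. -/
def verticalSubrectangles {S : Type*} [TopologicalSpace S] (f : S ≃ₜ S) {n : ℕ}
    (R : Fin n → GeometricRectangle S) (k : Fin n) : Set (Set S) :=
  ⋃ i, componentClosures (f '' (R i).inner ∩ (R k).inner)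

/-- The family `R` is a geometric Markov partition for the pseudo-Anosov homeomorphism `f` with
stable foliation `Fs` and unstable foliation `Fu`. -/
structure IsGeometricMarkovPartition {S : Type*} [TopologicalSpace S] [OrientedSurface S]
    (f : S ≃ₜ S) (Fs Fu : MeasuredFoliation S) {n : ℕ} (R : Fin n → GeometricRectangle S) :
    Prop where
  rectangle : ∀ i, IsParametrization Fs Fu (R i).param (R i).carrier
  cover : ⋃ i, (R i).carrier = univ
  disjoint : ∀ i j, i ≠ j → (R i).inner ∩ (R j).inner = ∅
  horizontal : ∀ i, ∀ H ∈ horizontalSubrectangles f R i, IsHorizontalSubrectangle Fs Fu (R i) H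
  vertical : ∀ k, ∀ V ∈ verticalSubrectangles f R k, IsVerticalSubrectangle Fs Fu (R k) V

/-! ### Geometric types -/

/-- Abstract geometric types `(n, (hᵢ, vᵢ), ρ, ε)`. -/
structure GeometricType where
  n : ℕ
  n_pos : 0 < n
  h : Fin n → ℕ
  v : Fin n → ℕ
  h_pos : ∀ i, 0 < h i
  v_pos : ∀ i, 0 < v i
  balance : ∑ i, h i = ∑ i, v i
  perm : (Σ i, Fin (h i)) ≃ (Σ k, Fin (v k))
  sign : (Σ i, Fin (h i)) → ℤˣ

/-- The vertical direction of `f (H)`, where `H ⊆ R`, agrees with the vertical direction of `R'`: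
whenever a vertical segment `{s} × [t, t']` of the interior of `R` lies in `H` and is mapped by `f`
into the interior of `R'`, then `f` maps it in the sense prescribed by the two directions. -/
def VerticalDirectionsCoincide {S : Type*} (f : S → S) (R R' : GeometricRectangle S)
    (H : Set S) : Prop :=
  ∀ s ∈ Ioo (0 : ℝ) 1, ∀ t ∈ Ioo (0 : ℝ) 1, ∀ t' ∈ Ioo (0 : ℝ) 1,
    (∀ τ ∈ uIcc t t', R.param (s, τ) ∈ H ∧ f (R.param (s, τ)) ∈ R'.inner) →
    ∀ p ∈ openSquare, ∀ p' ∈ openSquare,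
      f (R.param (s, t)) = R'.param p → f (R.param (s, t')) = R'.param p' →
      R.vCoord (s, t) < R.vCoord (s, t') → R'.vCoord p < R'.vCoord p'

/-- `T` is the geometric type of the geometric Markov partition `R` for `f`. The sets `H i j` are
the horizontal subrectangles of `R i`, labelled from bottom to top, and the sets `V k l` are the
vertical subrectangles of `R k`, labelled from left to right. -/
def IsGeometricType {S : Type*} [TopologicalSpace S] (f : S ≃ₜ S) {n : ℕ}
    (R : Fin n → GeometricRectangle S) (T : GeometricType) : Prop :=
  ∃ e : T.n = n, ∃ (H : ∀ i : Fin T.n, Fin (T.h i) → Set S)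
      (V : ∀ k : Fin T.n, Fin (T.v k) → Set S),
    (∀ i, BijOn (H i) univ (horizontalSubrectangles f R (Fin.cast e i)) ∧
      ∀ j j', j < j' → (R (Fin.cast e i)).Below (H i j) (H i j')) ∧
    (∀ k, BijOn (V k) univ (verticalSubrectangles f R (Fin.cast e k)) ∧
      ∀ l l', l < l' → (R (Fin.cast e k)).LeftOf (V k l) (V k l')) ∧
    (∀ a b, T.perm a = b ↔ f '' H a.1 a.2 = V b.1 b.2) ∧
    (∀ a, T.sign a = 1 ↔ VerticalDirectionsCoincide f (R (Fin.cast e a.1))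
      (R (Fin.cast e (T.perm a).1)) (H a.1 a.2))

/-!
A conjugacy carries rectangles, components and directions along with it, so the statement comes
down to two facts which are not formal: `h` maps the leaves of the foliations of `f` to leaves of
the foliations of `g`, although it is not assumed to respect the transverse measures, and a
geometric Markov partition has only finitely many subrectangles, linearly ordered in each rectangle.

**Leaves.** Let `f` multiply the transverse measure of `F` by `c > 1` and that of `G` by `c⁻¹`
(`Stretches`). The leaves of `F` are then characterized by the topological dynamics of `f`: `y` lies
on the leaf of `x` if and only if some path from `x` to `y` has forward images which become
arbitrarily small (`Stretches.mem_leaf_iff`). Asymptotic pairs of points would not do here: a pair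
of orbits can pass a `1`-prong on different sides again and again, so in the presence of `1`-prongs
points on different leaves can be asymptotic.

If `y` lies on the leaf of `x`, one can join them by a path of zero `F`-measure and finite
`G`-measure (`exists_path_measure_ne_top`). The `G`-measure of its images tends to zero, and paths
of small measure for both foliations are small (`exists_measure_bound`).

Conversely, let the images of a path become small. In a chart, `F` is described by the height
function `|Im (z ^ (k / 2))|`. Two height functions of `F` change locally by the same amount, since
near every point there are paths with monotone height; along a path the oscillation of one is at
most twice that of the other, as only the folding at height zero can make them differ
(`IsHeight.abs_sub_le_two_mul`). Apply this to the height in a fixed chart and to the bounded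
heights of charts containing the `n`-th image of the path, pulled back by `f ^ n` and hence rescaled
by `c ^ (-n)`: the height is constant along the path, which therefore has measure zero
(`Stretches.measure_eq_zero_of_shrinks`).

**Arcs.** The same comparison shows that a leaf meets a chart in countably many heights. So along a
connected set contained in a leaf of `F` and in a leaf of `G` both coordinates are locally constant,
and such a set is no arc (`not_injOn_of_mapsTo_leaf`).

**Subrectangles.** The components in a rectangle are disjoint bands of the square, because the
closure of each is a union of segments of the square; their projections to a side are disjoint
intervals, which order them (`exists_order_of_isBand`). If there were infinitely many components
between two rectangles, then their limit would be a horizontal segment mapped by `f` into a vertical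
one (`exists_segment_of_infinite_bands`), that is, an arc in a stable and an unstable leaf. Hence
the sets of subrectangles are finite and can be enumerated in exactly one way, which gives existence
and uniqueness of the geometric type.

**Orientations.** The images of the rectangles under `h` have orientation preserving
parametrizations since local degrees multiply (`PreservesOrientationAt.comp`).
-/

/-! ### The standard prong in the plane -/

theorem prongHeight_nonneg (k : ℕ) (z : ℂ) : 0 ≤ prongHeight k z := Real.sqrt_nonneg _

theorem prongWidth_nonneg (k : ℕ) (z : ℂ) : 0 ≤ prongWidth k z := Real.sqrt_nonneg _

theorem continuous_prongHeight (k : ℕ) : Continuous (prongHeight k) := by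
  unfold prongHeight; fun_prop

theorem prongHeight_sq (k : ℕ) (z : ℂ) : prongHeight k z ^ 2 = (‖z‖ ^ k - (z ^ k).re) / 2 := by
  have h := Complex.re_le_norm (z ^ k)
  rw [norm_pow] at h
  exact Real.sq_sqrt (by linarith)

theorem prongWidth_sq (k : ℕ) (z : ℂ) : prongWidth k z ^ 2 = (‖z‖ ^ k + (z ^ k).re) / 2 := by
  have h := (abs_le.1 (Complex.abs_re_le_norm (z ^ k))).1
  rw [norm_pow] at h
  exact Real.sq_sqrt (by linarith)

theorem norm_pow_eq_prong (k : ℕ) (z : ℂ) :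
    ‖z‖ ^ k = prongHeight k z ^ 2 + prongWidth k z ^ 2 := by
  rw [prongHeight_sq, prongWidth_sq]; ring

/-- A square root `ζ` of `z ^ k` is a coordinate `z ^ (k / 2)` which straightens both foliations. -/
theorem prongHeight_eq_abs_im {k : ℕ} {z ζ : ℂ} (h : ζ ^ 2 = z ^ k) :
    prongHeight k z = |ζ.im| := by
  have h1 : ‖ζ‖ ^ 2 = ‖z‖ ^ k := by rw [← norm_pow, h, norm_pow]
  rw [← abs_of_nonneg (prongHeight_nonneg k z), ← sq_eq_sq_iff_abs_eq_abs, prongHeight_sq, ← h1,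
    ← h, Complex.sq_norm, Complex.normSq_apply, sq ζ, Complex.mul_re]
  ring

theorem prongWidth_eq_abs_re {k : ℕ} {z ζ : ℂ} (h : ζ ^ 2 = z ^ k) :
    prongWidth k z = |ζ.re| := by
  have h1 : ‖ζ‖ ^ 2 = ‖z‖ ^ k := by rw [← norm_pow, h, norm_pow]
  rw [← abs_of_nonneg (prongWidth_nonneg k z), ← sq_eq_sq_iff_abs_eq_abs, prongWidth_sq, ← h1,
    ← h, Complex.sq_norm, Complex.normSq_apply, sq ζ, Complex.mul_re]
  ring

/-- The height and the width determine `z ^ k` up to conjugation, hence `z` up to finitely many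
possibilities. -/
theorem finite_setOf_prongHeight_eq {k : ℕ} (hk : 1 ≤ k) (a b : ℝ) :
    {z : ℂ | prongHeight k z = a ∧ prongWidth k z = b}.Finite := by
  have hfib : ∀ w : ℂ, {z : ℂ | z ^ k = w}.Finite := fun w => by
    refine (Polynomial.finite_setOfPred_isRoot (p := Polynomial.X ^ k - Polynomial.C w)
      (Polynomial.X_pow_sub_C_ne_zero (by omega) w)).subset fun z hz => ?_
    simpa [sub_eq_zero] using hz
  refine ((hfib (((b : ℂ) + a * Complex.I) ^ 2)).union
    (hfib (((b : ℂ) - a * Complex.I) ^ 2))).subset fun z hz => ?_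
  obtain ⟨ζ, hζ⟩ := IsAlgClosed.exists_pow_nat_eq (z ^ k) two_pos
  obtain ⟨h1, h2⟩ := hz
  rw [prongHeight_eq_abs_im hζ] at h1
  rw [prongWidth_eq_abs_re hζ] at h2
  have key : ∀ s t : ℝ, s ^ 2 = 1 → t ^ 2 = 1 → ζ.re = s * b → ζ.im = t * a →
      z ^ k = ((b : ℂ) + a * Complex.I) ^ 2 ∨ z ^ k = ((b : ℂ) - a * Complex.I) ^ 2 := by
    intro s t hs ht hre him
    have e : ζ = (s * b : ℝ) + (t * a : ℝ) * Complex.I := by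
      rw [← hre, ← him, Complex.re_add_im]
    rw [← hζ, e]
    rcases sq_eq_one_iff.1 hs with rfl | rfl <;>
      rcases sq_eq_one_iff.1 ht with rfl | rfl
    · left; push_cast; ring
    · right; push_cast; ring
    · right; push_cast; ring
    · left; push_cast; ring
  rcases abs_choice ζ.re with hs | hs <;> rcases abs_choice ζ.im with ht | ht
  · exact key 1 1 (by norm_num) (by norm_num) (by linarith) (by linarith)
  · exact key 1 (-1) (by norm_num) (by norm_num) (by linarith) (by linarith)
  · exact key (-1) 1 (by norm_num) (by norm_num) (by linarith) (by linarith)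
  · exact key (-1) (-1) (by norm_num) (by norm_num) (by linarith) (by linarith)

/-- Monotone or antitone along a path. -/
def MonotoneAlong {X : Type*} [TopologicalSpace X] {x y : X} (u : X → ℝ) (γ : Path x y) : Prop :=
  Monotone (fun t => u (γ t)) ∨ Antitone (fun t => u (γ t))

theorem monotone_or_antitone_abs_segment {a b : ℝ} (h : 0 ≤ a * b) :
    Monotone (fun t : unitInterval => |(1 - (t : ℝ)) * a + t * b|) ∨
      Antitone (fun t : unitInterval => |(1 - (t : ℝ)) * a + t * b|) := by
  have key : ∀ a b : ℝ, 0 ≤ a → 0 ≤ b →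
      Monotone (fun t : unitInterval => |(1 - (t : ℝ)) * a + t * b|) ∨
      Antitone (fun t : unitInterval => |(1 - (t : ℝ)) * a + t * b|) := by
    intro a b ha hb
    have e : ∀ t : unitInterval, |(1 - (t : ℝ)) * a + t * b| = a + t * (b - a) := fun t => by
      rw [abs_of_nonneg]
      · ring
      · have := t.2.1; have := t.2.2
        have := mul_nonneg (sub_nonneg.2 t.2.2) ha
        have := mul_nonneg t.2.1 hb
        linarith
    simp only [e]
    rcases le_total a b with h | h
    · left; intro s t hst
      have : (s : ℝ) ≤ t := hst
      simp only; nlinarith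
    · right; intro s t hst
      have : (s : ℝ) ≤ t := hst
      simp only; nlinarith
  rcases le_total 0 a with ha | ha <;> rcases le_total 0 b with hb | hb
  · exact key a b ha hb
  · rcases eq_or_lt_of_le ha with h0 | h0
    · have := key 0 (-b) le_rfl (by linarith)
      rw [← h0]
      simpa using this
    · have : b = 0 := by nlinarith
      exact key a b ha this.ge
  · rcases eq_or_lt_of_le hb with h0 | h0
    · have := key (-a) 0 (by linarith) le_rfl
      rw [← h0]
      simpa [abs_mul] using this
    · have : a = 0 := by nlinarith
      exact key a b this.ge hb
  · have := key (-a) (-b) (by linarith) (by linarith)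
    have e : ∀ t : unitInterval, |(1 - (t : ℝ)) * -a + t * -b| = |(1 - (t : ℝ)) * a + t * b| :=
      fun t => by rw [← abs_neg]; ring_nf
    simpa only [e] using this

/-- Near a point other than the centre, there is a branch `b` of `z ^ (k / 2)`, and segments in the
coordinate `b` are short paths. -/
theorem exists_branch {k : ℕ} (hk : 1 ≤ k) {z₀ : ℂ} (hz₀ : z₀ ≠ 0) :
    ∃ b : ℂ → ℂ, ContinuousAt b z₀ ∧ prongHeight k z₀ = |(b z₀).im| ∧
      ∀ W ∈ 𝓝 z₀, ∃ N ∈ 𝓝 z₀, ∀ z ∈ N, ∀ z' ∈ N, ∃ γ : Path z z', range γ ⊆ W ∧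
        ∀ t : unitInterval,
          prongHeight k (γ t) = |(1 - (t : ℝ)) * (b z).im + t * (b z').im| ∧
          prongWidth k (γ t) = |(1 - (t : ℝ)) * (b z).re + t * (b z').re| := by
  obtain ⟨ζ₀, hζ₀⟩ := IsAlgClosed.exists_pow_nat_eq (z₀ ^ k) two_pos
  have hk0 : (k : ℂ) ≠ 0 := by exact_mod_cast (by omega : k ≠ 0)
  set c : ℂ → ℂ := fun z => (z / z₀) ^ ((k : ℂ) / 2) with hc
  have hc0 : c z₀ = 1 := by simp [hc, hz₀]
  have hccont : ContinuousAt c z₀ := by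
    refine ContinuousAt.cpow (by fun_prop) continuousAt_const ?_
    simp [hz₀, Complex.one_mem_slitPlane]
  -- With principal powers `c` is a branch near `z₀` only, and there `inv` is its inverse.
  refine ⟨fun z => ζ₀ * c z, continuousAt_const.mul hccont, ?_, fun W hW => ?_⟩
  · rw [prongHeight_eq_abs_im hζ₀]; simp [hc0]
  set inv : ℂ → ℂ := fun m => z₀ * m ^ (2 / (k : ℂ)) with hinv
  have hinvcont : ∀ m ∈ Complex.slitPlane, ContinuousAt inv m := fun m hm =>
    continuousAt_const.mul (ContinuousAt.cpow continuousAt_id continuousAt_const hm)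
  have hinv1 : inv 1 = z₀ := by simp [hinv]
  have hWs : inv ⁻¹' W ∩ Complex.slitPlane ∈ 𝓝 (1 : ℂ) :=
    inter_mem ((hinvcont 1 Complex.one_mem_slitPlane).preimage_mem_nhds (by rwa [hinv1]))
      (Complex.isOpen_slitPlane.mem_nhds Complex.one_mem_slitPlane)
  obtain ⟨ε, hε, hball⟩ := Metric.mem_nhds_iff.1 hWs
  have hev1 : ∀ᶠ z in 𝓝 z₀, c z ∈ Metric.ball (1 : ℂ) ε :=
    hccont.eventually (by rw [hc0]; exact Metric.ball_mem_nhds _ hε)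
  have hev2 : ∀ᶠ z in 𝓝 z₀, inv (c z) = z := by
    have hlog : ContinuousAt (fun z : ℂ => (Complex.log (z / z₀) * ((k : ℂ) / 2)).im) z₀ := by
      refine Complex.continuous_im.continuousAt.comp
        (ContinuousAt.mul (ContinuousAt.clog (by fun_prop) ?_) continuousAt_const)
      simp [hz₀, Complex.one_mem_slitPlane]
    have h0 : (Complex.log (z₀ / z₀) * ((k : ℂ) / 2)).im = 0 := by simp [hz₀]
    have hI : Ioo (-Real.pi) Real.pi ∈ 𝓝 ((Complex.log (z₀ / z₀) * ((k : ℂ) / 2)).im) := by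
      rw [h0]; exact Ioo_mem_nhds (neg_lt_zero.2 Real.pi_pos) Real.pi_pos
    filter_upwards [hlog.eventually hI] with z hz
    have := Complex.cpow_mul (2 / (k : ℂ)) hz.1 hz.2.le
    simp only [hinv, hc]
    rw [← this]
    have e : (k : ℂ) / 2 * (2 / k) = 1 := by field_simp
    rw [e, Complex.cpow_one]; field_simp
  refine ⟨_, inter_mem hev1 hev2, ?_⟩
  rintro z ⟨hz1, hz2⟩ z' ⟨hz1', hz2'⟩
  set m : unitInterval → ℂ := fun t => (1 - (t : ℝ) : ℂ) * c z + (t : ℝ) * c z' with hm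
  have hmball : ∀ t, m t ∈ Metric.ball (1 : ℂ) ε := fun t => by
    have := (convex_ball (1 : ℂ) ε) hz1 hz1' (sub_nonneg.2 t.2.2) t.2.1 (by ring)
    simpa [hm, Complex.real_smul] using this
  have hmcont : Continuous m := by simp only [hm]; fun_prop
  let γ : Path z z' :=
    { toFun := fun t => inv (m t)
      continuous_toFun := continuous_iff_continuousAt.2 fun t =>
        (hinvcont _ (hball (hmball t)).2).comp hmcont.continuousAt
      source' := by simpa [hm] using hz2
      target' := by simpa [hm] using hz2' }
  refine ⟨γ, ?_, fun t => ?_⟩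
  · rintro _ ⟨t, rfl⟩
    exact (hball (hmball t)).1
  have hpow : (ζ₀ * m t) ^ 2 = (γ t) ^ k := by
    change _ = (z₀ * m t ^ (2 / (k : ℂ))) ^ k
    rw [mul_pow, mul_pow, hζ₀, ← Complex.cpow_nat_mul]
    congr 1
    rw [mul_div_cancel₀ _ hk0]
    exact (Complex.cpow_natCast _ 2).symm
  have e : ζ₀ * m t = (1 - (t : ℝ) : ℝ) * (ζ₀ * c z) + (t : ℝ) * (ζ₀ * c z') := by
    simp only [hm]; push_cast; ring
  rw [prongHeight_eq_abs_im hpow, prongWidth_eq_abs_re hpow, e]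
  constructor
  · rw [Complex.add_im, Complex.im_ofReal_mul, Complex.im_ofReal_mul]
  · rw [Complex.add_re, Complex.re_ofReal_mul, Complex.re_ofReal_mul]

theorem ContinuousAt.eventually_mul_nonneg {X : Type*} [TopologicalSpace X] {f : X → ℝ} {x : X}
    (hf : ContinuousAt f x) : ∀ᶠ y in 𝓝 x, 0 ≤ f x * f y := by
  rcases lt_trichotomy (f x) 0 with h | h | h
  · filter_upwards [hf.eventually (gt_mem_nhds h)] with y hy
    nlinarith
  · exact Eventually.of_forall fun y => by simp [h]
  · filter_upwards [hf.eventually (lt_mem_nhds h)] with y hy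
    positivity

/-- Every point near `z₀` can be reached from `z₀` by a short path along which the height and the
width are monotone. -/
theorem exists_monotone_path {k : ℕ} (hk : 1 ≤ k) (z₀ : ℂ) {W : Set ℂ} (hW : W ∈ 𝓝 z₀) :
    ∃ N ∈ 𝓝 z₀, ∀ z ∈ N, ∃ γ : Path z₀ z, range γ ⊆ W ∧
      MonotoneAlong (prongHeight k) γ ∧ MonotoneAlong (prongWidth k) γ := by
  rcases eq_or_ne z₀ 0 with rfl | hz₀
  · obtain ⟨ε, hε, hball⟩ := Metric.mem_nhds_iff.1 hW
    refine ⟨_, Metric.ball_mem_nhds _ hε, fun z hz => ?_⟩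
    let γ : Path (0 : ℂ) z :=
      { toFun := fun t => (t : ℝ) * z
        continuous_toFun := by fun_prop
        source' := by simp
        target' := by simp }
    have hn : ∀ t : unitInterval, ‖((t : ℝ) * z : ℂ)‖ = t * ‖z‖ := fun t => by
      rw [norm_mul, Complex.norm_real, Real.norm_of_nonneg t.2.1]
    have hre : ∀ t : unitInterval, (((t : ℝ) * z : ℂ) ^ k).re = (t : ℝ) ^ k * (z ^ k).re :=
      fun t => by rw [mul_pow, ← Complex.ofReal_pow, Complex.re_ofReal_mul]
    have hz2 := abs_le.1 (Complex.abs_re_le_norm (z ^ k))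
    rw [norm_pow] at hz2
    refine ⟨γ, ?_, Or.inl fun s t hst => ?_, Or.inl fun s t hst => ?_⟩
    · rintro _ ⟨t, rfl⟩
      refine hball ?_
      have hz' : ‖z‖ < ε := by simpa using hz
      have : ‖((t : ℝ) * z : ℂ)‖ < ε := by
        rw [hn]
        exact (mul_le_of_le_one_left (norm_nonneg z) t.2.2).trans_lt hz'
      rw [Metric.mem_ball, dist_zero_right]
      exact this
    · have hp : (s : ℝ) ^ k ≤ (t : ℝ) ^ k := pow_le_pow_left₀ s.2.1 hst k
      change prongHeight k ((s : ℝ) * z) ≤ prongHeight k ((t : ℝ) * z)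
      refine Real.sqrt_le_sqrt ?_
      rw [hn, hn, hre, hre, mul_pow, mul_pow]
      nlinarith
    · have hp : (s : ℝ) ^ k ≤ (t : ℝ) ^ k := pow_le_pow_left₀ s.2.1 hst k
      change prongWidth k ((s : ℝ) * z) ≤ prongWidth k ((t : ℝ) * z)
      refine Real.sqrt_le_sqrt ?_
      rw [hn, hn, hre, hre, mul_pow, mul_pow]
      nlinarith
  · obtain ⟨b, hb, -, hpath⟩ := exists_branch hk hz₀
    obtain ⟨N, hN, hpath⟩ := hpath W hW
    have h1 := (Complex.continuous_im.continuousAt.comp hb).eventually_mul_nonneg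
    have h2 := (Complex.continuous_re.continuousAt.comp hb).eventually_mul_nonneg
    refine ⟨_, inter_mem hN (h1.and h2), fun z hz => ?_⟩
    obtain ⟨γ, hγ, hγ'⟩ := hpath z₀ (mem_of_mem_nhds hN) z hz.1
    refine ⟨γ, hγ, ?_, ?_⟩
    · simpa only [MonotoneAlong, (hγ' _).1, Function.comp_apply] using
        monotone_or_antitone_abs_segment hz.2.1
    · simpa only [MonotoneAlong, (hγ' _).2, Function.comp_apply] using
        monotone_or_antitone_abs_segment hz.2.2

/-- Near a point of positive height any two points can be joined by a short path along which the
height is monotone. -/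
theorem exists_monotone_path_of_pos {k : ℕ} (hk : 1 ≤ k) {z₀ : ℂ} (hz₀ : 0 < prongHeight k z₀)
    {W : Set ℂ} (hW : W ∈ 𝓝 z₀) :
    ∃ N ∈ 𝓝 z₀, ∀ z ∈ N, ∀ z' ∈ N, ∃ γ : Path z z', range γ ⊆ W ∧
      MonotoneAlong (prongHeight k) γ := by
  have hne : z₀ ≠ 0 := by
    rintro rfl
    simp [prongHeight, show k ≠ 0 by omega] at hz₀
  obtain ⟨b, hb, hb0, hpath⟩ := exists_branch hk hne
  obtain ⟨N, hN, hpath⟩ := hpath W hW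
  have h1 := (Complex.continuous_im.continuousAt.comp hb).eventually_mul_nonneg
  refine ⟨_, inter_mem hN h1, fun z hz z' hz' => ?_⟩
  obtain ⟨γ, hγ, hγ'⟩ := hpath z hz.1 z' hz'.1
  refine ⟨γ, hγ, ?_⟩
  have hsign : 0 ≤ (b z).im * (b z').im := by
    have h2 : 0 ≤ (b z₀).im * (b z).im := hz.2
    have h3 : 0 ≤ (b z₀).im * (b z').im := hz'.2
    have h4 : 0 < (b z₀).im ^ 2 := by
      rw [← sq_abs, ← hb0]; positivity
    have h5 := mul_nonneg h2 h3
    by_contra! hcon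
    nlinarith
  simpa only [MonotoneAlong, (hγ' _).1] using monotone_or_antitone_abs_segment hsign

/-- A positive height is not locally constant. -/
theorem frequently_prongHeight_ne {k : ℕ} (hk : 1 ≤ k) {z₀ : ℂ} (hz₀ : 0 < prongHeight k z₀) :
    ∃ᶠ z in 𝓝 z₀, prongHeight k z ≠ prongHeight k z₀ := by
  have ht : Tendsto (fun r : ℝ => (r : ℂ) * z₀) (𝓝[>] 1) (𝓝 z₀) := by
    have : ContinuousAt (fun r : ℝ => (r : ℂ) * z₀) 1 := by fun_prop
    simpa using this.tendsto.mono_left nhdsWithin_le_nhds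
  refine ht.frequently (Eventually.frequently ?_)
  filter_upwards [self_mem_nhdsWithin] with r hr h
  have hr : 1 < r := hr
  have h2 := congrArg (· ^ 2) h
  simp only [prongHeight_sq] at h2
  rw [norm_mul, Complex.norm_real, Real.norm_of_nonneg (by linarith), mul_pow, mul_pow,
    ← Complex.ofReal_pow, Complex.re_ofReal_mul] at h2
  have h3 : (‖z₀‖ ^ k - (z₀ ^ k).re) / 2 > 0 := by rw [← prongHeight_sq]; positivity
  have h4 : 1 < r ^ k := one_lt_pow₀ hr (by omega)
  nlinarith

/-- Rotation by `π / k` exchanges the two standard foliations. -/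
theorem exists_rotation {k : ℕ} (hk : 1 ≤ k) : ∃ a : ℂ, a ≠ 0 ∧
    ∀ z, prongHeight k (a * z) = prongWidth k z ∧ prongWidth k (a * z) = prongHeight k z := by
  obtain ⟨a, ha⟩ := IsAlgClosed.exists_pow_nat_eq (-1 : ℂ) (n := k) (by omega)
  have hn : ‖a‖ = 1 := by
    have := congrArg norm ha
    rw [norm_pow, norm_neg, norm_one] at this
    exact (pow_eq_one_iff_of_nonneg (norm_nonneg a) (by omega)).1 this
  refine ⟨a, fun h => by simp [h] at hn, fun z => ?_⟩
  simp [prongHeight, prongWidth, mul_pow, ha, hn, sub_eq_add_neg]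

/-! ### Paths and transverse measures -/

section Paths

variable {S : Type*} [TopologicalSpace S]

/-- A property of paths which is stable under concatenation and holds for all paths contained in
one member of an open cover holds for all paths: halve the path until the Lebesgue number of the
cover is reached. -/
theorem Path.induction_on_cover {ι : Type*} {U : ι → Set S} (hU : ∀ i, IsOpen (U i))
    (hcov : ⋃ i, U i = univ) {P : ∀ x y : S, Path x y → Prop}
    (hbase : ∀ x y (γ : Path x y) i, range γ ⊆ U i → P x y γ)
    (htrans : ∀ x y z (γ : Path x y) (δ : Path y z), P x y γ → P y z δ → P x z (γ.trans δ))
    {x y : S} (γ : Path x y) : P x y γ := by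
  have key : ∀ n : ℕ, ∀ x y : S, ∀ γ : Path x y,
      (∀ a : unitInterval, ∃ i, ∀ t : unitInterval, |(t : ℝ) - a| ≤ (1 / 2) ^ n → γ t ∈ U i) →
        P x y γ := by
    intro n
    induction n with
    | zero =>
      intro x y γ h
      obtain ⟨i, hi⟩ := h 0
      refine hbase x y γ i ?_
      rintro _ ⟨t, rfl⟩
      refine hi t ?_
      rw [Icc.coe_zero, sub_zero, abs_of_nonneg t.2.1]
      simpa using t.2.2
    | succ n ih =>
      intro x y γ h
      let γ₁ : Path x (γ ⟨1 / 2, by norm_num, by norm_num⟩) :=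
        { toFun := fun t => γ ⟨t / 2, by linarith [t.2.1], by linarith [t.2.2]⟩
          continuous_toFun := by fun_prop
          source' := by simp
          target' := by simp }
      let γ₂ : Path (γ ⟨1 / 2, by norm_num, by norm_num⟩) y :=
        { toFun := fun t => γ ⟨(t + 1) / 2, by linarith [t.2.1], by linarith [t.2.2]⟩
          continuous_toFun := by fun_prop
          source' := by simp
          target' := by simp }
      have e : γ = γ₁.trans γ₂ := by
        ext t
        rw [Path.trans_apply]
        split_ifs with ht
        · change γ t = γ _
          congr 1; ext; simp
        · change γ t = γ _
          congr 1; ext; simp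
      rw [e]
      have half : ∀ s t : ℝ, |s - t| ≤ (1 / 2) ^ n → |s / 2 - t / 2| ≤ (1 / 2) ^ (n + 1) := by
        intro s t hst
        rw [← sub_div, abs_div, abs_of_pos (two_pos : (0 : ℝ) < 2), pow_succ]
        linarith
      refine htrans _ _ _ _ _ (ih _ _ _ fun a => ?_) (ih _ _ _ fun a => ?_)
      · obtain ⟨i, hi⟩ := h ⟨a / 2, by linarith [a.2.1], by linarith [a.2.2]⟩
        exact ⟨i, fun t ht => hi ⟨t / 2, by linarith [t.2.1], by linarith [t.2.2]⟩ (half _ _ ht)⟩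
      · obtain ⟨i, hi⟩ := h ⟨(a + 1) / 2, by linarith [a.2.1], by linarith [a.2.2]⟩
        refine ⟨i, fun t ht => hi ⟨(t + 1) / 2, by linarith [t.2.1], by linarith [t.2.2]⟩
          (half _ _ ?_)⟩
        simpa using ht
  obtain ⟨δ, hδ, hleb⟩ := lebesgue_number_lemma_of_metric (s := (univ : Set unitInterval))
    isCompact_univ (fun i => (hU i).preimage γ.continuous)
    (by rw [← preimage_iUnion, hcov, preimage_univ])
  obtain ⟨n, hn⟩ := exists_pow_lt_of_lt_one hδ (by norm_num : (1 / 2 : ℝ) < 1)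
  refine key n x y γ fun a => ?_
  obtain ⟨i, hi⟩ := hleb a (mem_univ a)
  refine ⟨i, fun t ht => hi ?_⟩
  rw [Metric.mem_ball, Subtype.dist_eq, Real.dist_eq]
  exact ht.trans_lt hn

theorem pathVariation_eq_zero_iff {x y : S} (u : S → ℝ) (γ : Path x y) :
    pathVariation u γ = 0 ↔ ∀ s t, u (γ s) = u (γ t) := by
  simp [pathVariation, eVariationOn.eq_zero_iff, edist_eq_zero]

theorem ofReal_abs_sub_le_pathVariation {x y : S} (u : S → ℝ) (γ : Path x y)
    (s t : unitInterval) : ENNReal.ofReal |u (γ s) - u (γ t)| ≤ pathVariation u γ := by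
  rw [← Real.dist_eq, ← edist_dist]
  exact eVariationOn.edist_le (fun t => u (γ t)) (mem_univ s) (mem_univ t)

theorem MonotoneAlong.symm {x y : S} {u : S → ℝ} {γ : Path x y} (h : MonotoneAlong u γ) :
    MonotoneAlong u γ.symm := by
  rcases h with h | h
  · exact Or.inr (h.comp_antitone unitInterval.strictAnti_symm.antitone)
  · exact Or.inl (h.comp unitInterval.strictAnti_symm.antitone)

theorem MonotoneAlong.pathVariation_le {x y : S} {u : S → ℝ} {γ : Path x y}
    (h : MonotoneAlong u γ) : pathVariation u γ ≤ ENNReal.ofReal |u y - u x| := by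
  have key : ∀ {x y : S} (γ : Path x y), Monotone (fun t => u (γ t)) →
      pathVariation u γ ≤ ENNReal.ofReal |u y - u x| := by
    intro x y γ h
    have h1 := (h.monotoneOn univ).eVariationOn_eq (mem_univ (0 : unitInterval)) (mem_univ 1)
    rw [← unitInterval.univ_eq_Icc, inter_self, γ.source, γ.target] at h1
    exact h1.le.trans (ENNReal.ofReal_le_ofReal (le_abs_self _))
  rcases h with h | h
  · exact key γ h
  · have h1 := key γ.symm (h.comp unitInterval.strictAnti_symm.antitone)
    rw [abs_sub_comm] at h1
    have h2 := eVariationOn.comp_eq_of_antitoneOn (fun t => u (γ t)) (t := univ) unitInterval.symm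
      (unitInterval.strictAnti_symm.antitone.antitoneOn _)
    rw [image_univ, unitInterval.symm_bijective.surjective.range_eq] at h2
    exact h2.symm.le.trans h1

theorem MeasuredFoliation.measure_congr (F : MeasuredFoliation S) {x y x' y' : S} {γ : Path x y}
    {γ' : Path x' y'} (h : ∀ t, γ t = γ' t) : F.measure γ = F.measure γ' := by
  obtain rfl : x = x' := by rw [← γ.source, ← γ'.source, h]
  obtain rfl : y = y' := by rw [← γ.target, ← γ'.target, h]
  congr 1
  ext t
  exact h t

end Paths

/-! ### Height functions of a foliation -/

section Heights

variable {S : Type*} [TopologicalSpace S] {F G : MeasuredFoliation S}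

/-- `u` is a height function of the foliation `F` on the open set `O`: the transverse measure of
a path in `O` is the variation of `u` along it, and `u` has the local properties of
`|Im (z ^ (k / 2))|` in a chart. Unlike a chart, this notion is stable under pulling back by a map
which multiplies the transverse measure by a constant. -/
structure IsHeight (F : MeasuredFoliation S) (O : Set S) (u : S → ℝ) : Prop where
  isOpen : IsOpen O
  continuousOn : ContinuousOn u O
  nonneg : ∀ q, 0 ≤ u q
  measure_eq : ∀ {x y : S} (γ : Path x y), range γ ⊆ O → F.measure γ = pathVariation u γ
  exists_path : ∀ x ∈ O, ∀ W ∈ 𝓝 x, ∃ N ∈ 𝓝 x, ∀ y ∈ N, ∃ γ : Path x y,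
    range γ ⊆ W ∧ MonotoneAlong u γ
  exists_path_of_pos : ∀ x ∈ O, 0 < u x → ∀ W ∈ 𝓝 x, ∃ N ∈ 𝓝 x, ∀ y ∈ N, ∀ y' ∈ N,
    ∃ γ : Path y y', range γ ⊆ W ∧ MonotoneAlong u γ
  frequently_ne : ∀ x ∈ O, 0 < u x → ∃ᶠ y in 𝓝 x, u y ≠ u x

/-- Along a monotone path for the height `u`, any other height `v` changes at most as much as `u`,
since both compute the same transverse measure. -/
theorem IsHeight.abs_sub_le_of_monotoneAlong {O O' : Set S} {u v : S → ℝ} (hu : IsHeight F O u)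
    (hv : IsHeight F O' v) {x y : S} {γ : Path x y} (h : range γ ⊆ O ∩ O')
    (hm : MonotoneAlong u γ) : |v y - v x| ≤ |u y - u x| := by
  have h1 := ofReal_abs_sub_le_pathVariation v γ 1 0
  rw [← hv.measure_eq γ (h.trans inter_subset_right),
    hu.measure_eq γ (h.trans inter_subset_left), γ.source, γ.target] at h1
  exact (ENNReal.ofReal_le_ofReal_iff (abs_nonneg _)).1 (h1.trans hm.pathVariation_le)

theorem IsHeight.eventually_abs_sub_eq {O O' : Set S} {u v : S → ℝ} (hu : IsHeight F O u)
    (hv : IsHeight F O' v) {x : S} (hx : x ∈ O) (hx' : x ∈ O') :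
    ∀ᶠ y in 𝓝 x, |u y - u x| = |v y - v x| := by
  have hW : O ∩ O' ∈ 𝓝 x := inter_mem (hu.isOpen.mem_nhds hx) (hv.isOpen.mem_nhds hx')
  obtain ⟨N, hN, h1⟩ := hu.exists_path x hx _ hW
  obtain ⟨N', hN', h2⟩ := hv.exists_path x hx' _ hW
  filter_upwards [hN, hN'] with y hy hy'
  obtain ⟨γ, hγ, hγ'⟩ := h1 y hy
  obtain ⟨δ, hδ, hδ'⟩ := h2 y hy'
  exact le_antisymm (hv.abs_sub_le_of_monotoneAlong hu (by rwa [inter_comm]) hδ')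
    (hu.abs_sub_le_of_monotoneAlong hv hγ hγ')

/-- Two height functions which are positive at `x` agree near `x` up to a sign and a constant. -/
theorem IsHeight.eventually_eq_or {O O' : Set S} {u v : S → ℝ} (hu : IsHeight F O u)
    (hv : IsHeight F O' v) {x : S} (hx : x ∈ O) (hx' : x ∈ O') (hux : 0 < u x) (hvx : 0 < v x) :
    (∀ᶠ y in 𝓝 x, u y - v y = u x - v x) ∨ (∀ᶠ y in 𝓝 x, u y + v y = u x + v x) := by
  have hW : O ∩ O' ∈ 𝓝 x := inter_mem (hu.isOpen.mem_nhds hx) (hv.isOpen.mem_nhds hx')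
  obtain ⟨N, hN, h1⟩ := hu.exists_path_of_pos x hx hux _ hW
  obtain ⟨N', hN', h2⟩ := hv.exists_path_of_pos x hx' hvx _ hW
  have key : ∀ y ∈ N ∩ N', ∀ y' ∈ N ∩ N', |u y' - u y| = |v y' - v y| := by
    intro y hy y' hy'
    obtain ⟨γ, hγ, hγ'⟩ := h1 y hy.1 y' hy'.1
    obtain ⟨δ, hδ, hδ'⟩ := h2 y hy.2 y' hy'.2
    exact le_antisymm (hv.abs_sub_le_of_monotoneAlong hu (by rwa [inter_comm]) hδ')
      (hu.abs_sub_le_of_monotoneAlong hv hγ hγ')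
  have hNN : N ∩ N' ∈ 𝓝 x := inter_mem hN hN'
  have hx0 := mem_of_mem_nhds hNN
  by_cases hpos : ∃ y ∈ N ∩ N', u y - v y ≠ u x - v x
  · obtain ⟨y, hy, hne⟩ := hpos
    right
    filter_upwards [hNN] with y' hy'
    have e1 := abs_eq_abs.1 (key x hx0 y hy)
    have e2 := abs_eq_abs.1 (key x hx0 y' hy')
    have e3 := abs_eq_abs.1 (key y hy y' hy')
    rcases e1 with e1 | e1 <;> rcases e2 with e2 | e2 <;> rcases e3 with e3 | e3 <;>
      first
      | linarith
      | exact absurd (by linarith) hne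
  · push Not at hpos
    left
    filter_upwards [hNN] with y hy using hpos y hy

theorem isOpen_setOf_eventually_eq (D : S → ℝ) : IsOpen {x | ∀ᶠ y in 𝓝 x, D y = D x} := by
  refine isOpen_iff_mem_nhds.2 fun x hx => ?_
  have hx : ∀ᶠ y in 𝓝 x, D y = D x := hx
  filter_upwards [hx, hx.eventually_nhds] with y hy hy'
  change ∀ᶠ z in 𝓝 y, D z = D y
  rw [hy]
  exact hy'

theorem eq_of_eventually_eq_on_Ioo {D : S → ℝ} {η : ℝ → S} (hη : Continuous η) {a b : ℝ}
    (h : ∀ t ∈ Ioo a b, ∀ᶠ y in 𝓝 (η t), D y = D (η t)) {s t : ℝ} (hs : s ∈ Ioo a b)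
    (ht : t ∈ Ioo a b) : D (η s) = D (η t) :=
  isPreconnected_Ioo.induction₂ (fun s t => D (η s) = D (η t))
    (fun r hr => nhdsWithin_le_nhds ((hη.continuousAt.eventually (h r hr)).mono fun _ h => h.symm))
    (fun _ _ _ _ _ _ => Eq.trans) (fun _ _ _ _ => Eq.symm) hs ht

/-- As long as two heights are positive along a curve, they change by the same amount. -/
theorem IsHeight.abs_sub_eq_of_pos {O O' : Set S} {u v : S → ℝ} (hu : IsHeight F O u)
    (hv : IsHeight F O' v) {η : ℝ → S} (hη : Continuous η) (hO : ∀ t, η t ∈ O)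
    (hO' : ∀ t, η t ∈ O') {a b : ℝ} (hab : a < b)
    (hpos : ∀ t ∈ Ioo a b, 0 < u (η t) ∧ 0 < v (η t)) :
    |u (η a) - u (η b)| = |v (η a) - v (η b)| := by
  have hcu : Continuous fun t => u (η t) := hu.continuousOn.comp_continuous hη hO
  have hcv : Continuous fun t => v (η t) := hv.continuousOn.comp_continuous hη hO'
  -- The sign relating the two heights is locally constant on the surface, hence constant along
  -- the curve, even where the curve stays at the same height and does not see the sign.
  set A : Set ℝ := η ⁻¹' {x | ∀ᶠ y in 𝓝 x, (fun q => u q - v q) y = (fun q => u q - v q) x}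
  set B : Set ℝ := η ⁻¹' {x | ∀ᶠ y in 𝓝 x, (fun q => u q + v q) y = (fun q => u q + v q) x}
  have hA : IsOpen A := (isOpen_setOf_eventually_eq _).preimage hη
  have hB : IsOpen B := (isOpen_setOf_eventually_eq _).preimage hη
  have hcov : Ioo a b ⊆ A ∪ B := fun t ht =>
    hu.eventually_eq_or hv (hO t) (hO' t) (hpos t ht).1 (hpos t ht).2
  have hdisj : Ioo a b ∩ (A ∩ B) = ∅ := by
    refine eq_empty_of_forall_notMem fun t ht => ?_
    refine hu.frequently_ne _ (hO t) (hpos t ht.1).1 ?_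
    have h1 : ∀ᶠ y in 𝓝 (η t), u y - v y = u (η t) - v (η t) := ht.2.1
    have h2 : ∀ᶠ y in 𝓝 (η t), u y + v y = u (η t) + v (η t) := ht.2.2
    filter_upwards [h1, h2] with y h1 h2
    simp only [ne_eq, not_not]
    linarith
  have hI : ∀ s ∈ Ioo a b, ∀ t ∈ Ioo a b, |u (η s) - u (η t)| = |v (η s) - v (η t)| := by
    intro s hs t ht
    rcases isPreconnected_iff_subset_of_disjoint.1 isPreconnected_Ioo A B hA hB hcov hdisj with
      h | h
    · have := eq_of_eventually_eq_on_Ioo (D := fun q => u q - v q) hη h hs ht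
      congr 1; linarith
    · have := eq_of_eventually_eq_on_Ioo (D := fun q => u q + v q) hη h hs ht
      rw [← abs_neg]; congr 1; linarith
  have hcl : IsClosed {p : ℝ × ℝ | |u (η p.1) - u (η p.2)| = |v (η p.1) - v (η p.2)|} :=
    isClosed_eq ((hcu.comp continuous_fst).sub (hcu.comp continuous_snd)).abs
      ((hcv.comp continuous_fst).sub (hcv.comp continuous_snd)).abs
  have hsub : Ioo a b ×ˢ Ioo a b ⊆
      {p : ℝ × ℝ | |u (η p.1) - u (η p.2)| = |v (η p.1) - v (η p.2)|} :=
    fun p hp => hI _ hp.1 _ hp.2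
  have h2 := closure_minimal hsub hcl
  rw [closure_prod_eq, closure_Ioo hab.ne] at h2
  exact @h2 (a, b) ⟨left_mem_Icc.2 hab.le, right_mem_Icc.2 hab.le⟩

end Heights

/-- The real-variable part of the comparison of two heights `u`, `v` along a curve. Near each time
they change by the same amount, and where both are positive this persists. At a zero of one of
them that function folds while the other one may cross, which costs the factor `2`. -/
theorem abs_sub_le_two_mul_of_folding {u v : ℝ → ℝ} (hu : Continuous u) (hv : Continuous v)
    (hu0 : ∀ t, 0 ≤ u t) (hv0 : ∀ t, 0 ≤ v t)
    (hloc : ∀ t₀, ∀ᶠ t in 𝓝 t₀, |u t - u t₀| = |v t - v t₀|)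
    (hpos : ∀ a b, a < b → (∀ t ∈ Ioo a b, 0 < u t ∧ 0 < v t) → |u a - u b| = |v a - v b|)
    {ω : ℝ} (hω : ∀ s t, |v s - v t| ≤ ω) (s t : ℝ) : |u s - u t| ≤ 2 * ω := by
  have hω0 : 0 ≤ ω := (abs_nonneg _).trans (hω 0 0)
  have hcomp : ∀ (w : ℝ → ℝ) (c a b : ℝ), Continuous w →
      IsCompact {z ∈ Icc a b | w z = c} := fun w c a b hw =>
    isCompact_Icc.inter_right (isClosed_eq hw continuous_const)
  -- Between two zeros of `v` the function `u` returns to its value, as long as it is positive.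
  have hzeros : ∀ z₁ z₂, z₁ ≤ z₂ → v z₁ = 0 → v z₂ = 0 → (∀ t ∈ Ioo z₁ z₂, 0 < u t) →
      u z₁ = u z₂ := by
    intro z₁ z₂ hz h1 h2 hup
    obtain ⟨z, ⟨⟨hzI, hvz⟩, -, huz⟩, hmax⟩ :=
      ((hcomp v 0 z₁ z₂ hv).inter (hcomp u (u z₁) z₁ z₂ hu)).exists_isGreatest
        ⟨z₁, ⟨left_mem_Icc.2 hz, h1⟩, left_mem_Icc.2 hz, rfl⟩
    rcases hzI.2.eq_or_lt with rfl | hlt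
    · exact huz.symm
    exfalso
    obtain ⟨b, hb, hbloc⟩ := (mem_nhdsGT_iff_exists_Ioo_subset).1
      (mem_nhdsWithin_of_mem_nhds (hloc z) : _ ∈ 𝓝[>] z)
    have hb : z < b := hb
    have hvpos : ∀ t ∈ Ioo z b, t < z₂ → 0 < v t := by
      intro t ht htz
      refine (hv0 t).lt_of_ne fun h0 => ?_
      have hloc' : |u t - u z| = |v t - v z| := hbloc ht
      rw [← h0, hvz, sub_self, abs_zero, abs_eq_zero, sub_eq_zero] at hloc'
      have hI : t ∈ Icc z₁ z₂ := ⟨hzI.1.trans ht.1.le, htz.le⟩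
      exact absurd (hmax ⟨⟨hI, h0.symm⟩, hI, hloc'.trans huz⟩) (not_le.2 ht.1)
    set m := min ((z + b) / 2) z₂ with hm
    have hzm : z < m := lt_min (by linarith) hlt
    have hmb : m < b := (min_le_left _ _).trans_lt (by linarith)
    obtain ⟨g, ⟨hgI, hvg⟩, hmin⟩ := (hcomp v 0 m z₂ hv).exists_isLeast
      ⟨z₂, ⟨min_le_right _ _, le_rfl⟩, h2⟩
    have hzg : z < g := hzm.trans_le hgI.1
    have hgap : ∀ t ∈ Ioo z g, 0 < u t ∧ 0 < v t := by
      intro t ht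
      refine ⟨hup t ⟨hzI.1.trans_lt ht.1, ht.2.trans_le hgI.2⟩, ?_⟩
      rcases lt_or_ge t m with htm | htm
      · exact hvpos t ⟨ht.1, htm.trans hmb⟩ (ht.2.trans_le hgI.2)
      · refine (hv0 t).lt_of_ne fun h0 => ?_
        exact absurd (hmin ⟨⟨htm, ht.2.le.trans hgI.2⟩, h0.symm⟩) (not_le.2 ht.2)
    have hug := hpos z g hzg hgap
    rw [hvz, hvg, sub_self, abs_zero, abs_eq_zero, sub_eq_zero] at hug
    have hgI' : g ∈ Icc z₁ z₂ := ⟨hzI.1.trans hzg.le, hgI.2⟩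
    exact absurd (hmax ⟨⟨hgI', hvg⟩, hgI', hug.symm.trans huz⟩) (not_le.2 hzg)
  have hstep : ∀ a b, a ≤ b → (∀ t ∈ Ioo a b, 0 < u t ∧ 0 < v t) → |u a - u b| ≤ ω := by
    intro a b hab h
    rcases hab.eq_or_lt with rfl | hab
    · simpa using hω0
    · exact (hpos a b hab h).trans_le (hω a b)
  have hupos : ∀ a b, a ≤ b → (∀ t ∈ Ioo a b, 0 < u t) → |u a - u b| ≤ 2 * ω := by
    intro a b hab hup
    by_cases hz : ∃ z ∈ Icc a b, v z = 0
    · obtain ⟨z₁, ⟨hI₁, hv₁⟩, hmin⟩ := (hcomp v 0 a b hv).exists_isLeast hz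
      obtain ⟨z₂, ⟨hI₂, hv₂⟩, hmax⟩ := (hcomp v 0 a b hv).exists_isGreatest hz
      have h1 := hstep a z₁ hI₁.1 fun t ht => ⟨hup t ⟨ht.1, ht.2.trans_le hI₁.2⟩,
        (hv0 t).lt_of_ne fun h0 => absurd (hmin ⟨⟨ht.1.le, ht.2.le.trans hI₁.2⟩, h0.symm⟩)
          (not_le.2 ht.2)⟩
      have h2 := hstep z₂ b hI₂.2 fun t ht => ⟨hup t ⟨hI₂.1.trans_lt ht.1, ht.2⟩,
        (hv0 t).lt_of_ne fun h0 => absurd (hmax ⟨⟨hI₂.1.trans ht.1.le, ht.2.le⟩, h0.symm⟩)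
          (not_le.2 ht.1)⟩
      have h3 := hzeros z₁ z₂ (hmin ⟨hI₂, hv₂⟩) hv₁ hv₂ fun t ht =>
        hup t ⟨hI₁.1.trans_lt ht.1, ht.2.trans_le hI₂.2⟩
      rw [abs_le] at *
      constructor <;> linarith [h1.1, h1.2, h2.1, h2.2]
    · push Not at hz
      have := hstep a b hab fun t ht =>
        ⟨hup t ht, (hv0 t).lt_of_ne (hz t (Ioo_subset_Icc_self ht)).symm⟩
      linarith
  wlog hst : s ≤ t generalizing s t
  · rw [abs_sub_comm]; exact this t s (le_of_not_ge hst)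
  by_cases hz : ∃ z ∈ Icc s t, u z = 0
  · obtain ⟨z₁, ⟨hI₁, hu₁⟩, hmin⟩ := (hcomp u 0 s t hu).exists_isLeast hz
    obtain ⟨z₂, ⟨hI₂, hu₂⟩, hmax⟩ := (hcomp u 0 s t hu).exists_isGreatest hz
    have h1 := hupos s z₁ hI₁.1 fun r hr => (hu0 r).lt_of_ne fun h0 =>
      absurd (hmin ⟨⟨hr.1.le, hr.2.le.trans hI₁.2⟩, h0.symm⟩) (not_le.2 hr.2)
    have h2 := hupos z₂ t hI₂.2 fun r hr => (hu0 r).lt_of_ne fun h0 =>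
      absurd (hmax ⟨⟨hI₂.1.trans hr.1.le, hr.2.le⟩, h0.symm⟩) (not_le.2 hr.1)
    rw [abs_le] at *
    constructor <;> linarith [h1.1, h1.2, h2.1, h2.2, hu0 s, hu0 t]
  · push Not at hz
    exact hupos s t hst fun r hr => (hu0 r).lt_of_ne (hz r (Ioo_subset_Icc_self hr)).symm

section Oscillation

variable {S : Type*} [TopologicalSpace S] {F : MeasuredFoliation S}

/-- The oscillations along a path of two heights of the same foliation are comparable. -/
theorem IsHeight.abs_sub_le_two_mul {O O' : Set S} {u v : S → ℝ} (hu : IsHeight F O u)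
    (hv : IsHeight F O' v) {x y : S} (γ : Path x y) (hO : range γ ⊆ O) (hO' : range γ ⊆ O')
    {ω : ℝ} (hω : ∀ s t, |v (γ s) - v (γ t)| ≤ ω) (s t : unitInterval) :
    |u (γ s) - u (γ t)| ≤ 2 * ω := by
  have hη : Continuous γ.extend := γ.continuous_extend
  have hr : ∀ t, γ.extend t ∈ range γ := fun t => by rw [← γ.extend_range]; exact mem_range_self t
  have h1 : ∀ t, γ.extend t ∈ O := fun t => hO (hr t)
  have h2 : ∀ t, γ.extend t ∈ O' := fun t => hO' (hr t)
  have := abs_sub_le_two_mul_of_folding (u := fun t => u (γ.extend t))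
    (v := fun t => v (γ.extend t)) (hu.continuousOn.comp_continuous hη h1)
    (hv.continuousOn.comp_continuous hη h2) (fun t => hu.nonneg _) (fun t => hv.nonneg _)
    (fun t₀ => hη.continuousAt.eventually (hu.eventually_abs_sub_eq hv (h1 t₀) (h2 t₀)))
    (fun a b hab hpos => hu.abs_sub_eq_of_pos hv hη h1 h2 hab hpos)
    (ω := ω) (fun s t => by
      obtain ⟨s', hs'⟩ := hr s
      obtain ⟨t', ht'⟩ := hr t
      rw [← hs', ← ht']
      exact hω s' t') s t
  simpa using this

end Oscillation

/-! ### Foliated charts -/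

section Charts

variable {S : Type*} [TopologicalSpace S] {F G : MeasuredFoliation S}

/-- In the chart `φ` the foliations `F` and `G` are the standard horizontal and vertical measured
foliations with a `k`-prong at `0`. -/
structure IsFoliatedChart (F G : MeasuredFoliation S) (k : ℕ) (φ : OpenPartialHomeomorph S ℂ) :
    Prop where
  one_le : 1 ≤ k
  measure_fst : ∀ {x y : S} (γ : Path x y), range γ ⊆ φ.source →
    F.measure γ = pathVariation (fun q => prongHeight k (φ q)) γ
  measure_snd : ∀ {x y : S} (γ : Path x y), range γ ⊆ φ.source →
    G.measure γ = pathVariation (fun q => prongWidth k (φ q)) γ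

theorem MeasuredFoliation.Transverse.exists_isFoliatedChart (h : F.Transverse G) (p : S) :
    ∃ φ : OpenPartialHomeomorph S ℂ, p ∈ φ.source ∧ φ p = 0 ∧
      IsFoliatedChart F G (F.prongs p) φ := by
  obtain ⟨φ, hp, h0, hφ⟩ := h.2 p
  exact ⟨φ, hp, h0, F.one_le_prongs p, fun γ hγ => (hφ γ hγ).1, fun γ hγ => (hφ γ hγ).2⟩

theorem IsFoliatedChart.exists_rotation {k : ℕ} {φ : OpenPartialHomeomorph S ℂ}
    (h : IsFoliatedChart F G k φ) : ∃ a : ℂ, ∃ ha : a ≠ 0,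
      (∀ z, prongHeight k (a * z) = prongWidth k z) ∧
      IsFoliatedChart G F k (φ.transHomeomorph (Homeomorph.mulLeft₀ a ha)) := by
  obtain ⟨a, ha, hrot⟩ := _root_.exists_rotation h.one_le
  refine ⟨a, ha, fun z => (hrot z).1, h.one_le, fun γ hγ => ?_, fun γ hγ => ?_⟩
  · rw [h.measure_snd γ hγ]
    congr 1; ext q; exact (hrot _).1.symm
  · rw [h.measure_fst γ hγ]
    congr 1; ext q; exact (hrot _).2.symm

theorem MeasuredFoliation.Transverse.symm (h : F.Transverse G) : G.Transverse F := by
  refine ⟨h.1.symm, fun p => ?_⟩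
  obtain ⟨φ, hp, h0, hφ⟩ := h.exists_isFoliatedChart p
  obtain ⟨a, ha, -, hrot⟩ := hφ.exists_rotation
  refine ⟨φ.transHomeomorph (Homeomorph.mulLeft₀ a ha), hp, ?_, fun γ hγ => ?_⟩
  · change a * φ p = 0
    rw [h0, mul_zero]
  · rw [← h.1]
    exact ⟨hrot.measure_fst γ hγ, hrot.measure_snd γ hγ⟩

theorem OpenPartialHomeomorph.exists_path_lift (φ : OpenPartialHomeomorph S ℂ) {x y : S}
    (hx : x ∈ φ.source) (hy : y ∈ φ.source) {W : Set S} (γ : Path (φ x) (φ y))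
    (hγ : range γ ⊆ φ.target ∩ φ.symm ⁻¹' W) :
    ∃ δ : Path x y, range δ ⊆ W ∧ ∀ t, φ (δ t) = γ t := by
  have ht : ∀ t, γ t ∈ φ.target := fun t => (hγ (mem_range_self t)).1
  refine ⟨{ toFun := fun t => φ.symm (γ t)
            continuous_toFun := φ.continuousOn_symm.comp_continuous γ.continuous ht
            source' := by simp [hx]
            target' := by simp [hy] }, ?_, fun t => φ.right_inv (ht t)⟩
  rintro _ ⟨t, rfl⟩
  exact (hγ (mem_range_self t)).2

theorem OpenPartialHomeomorph.target_inter_preimage_mem_nhds (φ : OpenPartialHomeomorph S ℂ)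
    {x : S} (hx : x ∈ φ.source) {W : Set S} (hW : W ∈ 𝓝 x) :
    φ.target ∩ φ.symm ⁻¹' W ∈ 𝓝 (φ x) := by
  refine inter_mem (φ.open_target.mem_nhds (φ.map_source hx)) ?_
  refine (φ.continuousAt_symm (φ.map_source hx)).preimage_mem_nhds ?_
  rwa [φ.left_inv hx]

/-- Near a point of a foliated chart, every point can be reached by a short path along which both
the height and the width are monotone. -/
theorem IsFoliatedChart.exists_path {k : ℕ} {φ : OpenPartialHomeomorph S ℂ}
    (h : IsFoliatedChart F G k φ) {x : S} (hx : x ∈ φ.source) {W : Set S} (hW : W ∈ 𝓝 x) :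
    ∃ N ∈ 𝓝 x, ∀ y ∈ N, ∃ γ : Path x y, range γ ⊆ W ∧
      MonotoneAlong (fun q => prongHeight k (φ q)) γ ∧
      MonotoneAlong (fun q => prongWidth k (φ q)) γ := by
  obtain ⟨N, hN, hpath⟩ :=
    exists_monotone_path h.one_le (φ x) (φ.target_inter_preimage_mem_nhds hx hW)
  refine ⟨_, inter_mem (φ.open_source.mem_nhds hx) ((φ.continuousAt hx).preimage_mem_nhds hN),
    fun y hy => ?_⟩
  obtain ⟨γ, hγ, h1, h2⟩ := hpath _ hy.2
  obtain ⟨δ, hδ, e⟩ := φ.exists_path_lift hx hy.1 γ hγ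
  exact ⟨δ, hδ, by simpa only [MonotoneAlong, e] using h1,
    by simpa only [MonotoneAlong, e] using h2⟩

theorem IsFoliatedChart.isHeight {k : ℕ} {φ : OpenPartialHomeomorph S ℂ}
    (h : IsFoliatedChart F G k φ) :
    IsHeight F φ.source (fun q => prongHeight k (φ q)) where
  isOpen := φ.open_source
  continuousOn := (continuous_prongHeight k).comp_continuousOn φ.continuousOn
  nonneg q := prongHeight_nonneg k _
  measure_eq γ hγ := h.measure_fst γ hγ
  exists_path x hx W hW := by
    obtain ⟨N, hN, hpath⟩ := h.exists_path hx hW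
    refine ⟨N, hN, fun y hy => ?_⟩
    obtain ⟨γ, hγ, h1, -⟩ := hpath y hy
    exact ⟨γ, hγ, h1⟩
  exists_path_of_pos x hx hpos W hW := by
    obtain ⟨N, hN, hpath⟩ :=
      exists_monotone_path_of_pos h.one_le hpos (φ.target_inter_preimage_mem_nhds hx hW)
    refine ⟨_, inter_mem (φ.open_source.mem_nhds hx) ((φ.continuousAt hx).preimage_mem_nhds hN),
      fun y hy y' hy' => ?_⟩
    obtain ⟨γ, hγ, h1⟩ := hpath _ hy.2 _ hy'.2
    obtain ⟨δ, hδ, e⟩ := φ.exists_path_lift hy.1 hy'.1 γ hγ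
    exact ⟨δ, hδ, by simpa only [MonotoneAlong, e] using h1⟩
  frequently_ne x hx hpos := by
    have h1 := frequently_prongHeight_ne h.one_le hpos
    have h2 : Tendsto φ.symm (𝓝 (φ x)) (𝓝 x) := by
      simpa [φ.left_inv hx] using (φ.continuousAt_symm (φ.map_source hx)).tendsto
    refine h2.frequently ((h1.and_eventually (φ.open_target.mem_nhds (φ.map_source hx))).mono ?_)
    rintro z ⟨hz, hzt⟩
    rwa [φ.right_inv hzt]

theorem IsFoliatedChart.isHeight_snd {k : ℕ} {φ : OpenPartialHomeomorph S ℂ}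
    (h : IsFoliatedChart F G k φ) :
    IsHeight G φ.source (fun q => prongWidth k (φ q)) := by
  obtain ⟨a, ha, hw, hrot⟩ := h.exists_rotation
  have h1 : IsHeight G φ.source (fun q => prongHeight k (a * φ q)) := hrot.isHeight
  simpa only [hw] using h1

end Charts

/-! ### Stretching homeomorphisms and the dynamics of leaves -/

section Leaves

variable {S : Type*} [TopologicalSpace S] {F G : MeasuredFoliation S} {f : S ≃ₜ S} {c : ℝ≥0}

/-- `f` multiplies the transverse measure of `F` by `c > 1` and that of the transverse foliation
`G` by `c⁻¹`. Thus the leaves of `F` are contracted. -/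
structure Stretches (f : S ≃ₜ S) (F G : MeasuredFoliation S) (c : ℝ≥0) : Prop where
  one_lt : 1 < c
  transverse : F.Transverse G
  measure_fst : ∀ {x y : S} (γ : Path x y), F.measure (γ.map f.continuous) = c * F.measure γ
  measure_snd : ∀ {x y : S} (γ : Path x y),
    G.measure (γ.map f.continuous) = (c⁻¹ : ℝ≥0) * G.measure γ

theorem Stretches.pos (h : Stretches f F G c) : 0 < c := zero_lt_one.trans h.one_lt

theorem Stretches.measure_fst_iterate (h : Stretches f F G c) {x y : S} (γ : Path x y) (n : ℕ) :
    F.measure (γ.map (f.continuous.iterate n)) = c ^ n * F.measure γ := by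
  induction n with
  | zero => rw [pow_zero, one_mul]; exact F.measure_congr fun t => rfl
  | succ n ih =>
    rw [pow_succ', mul_assoc, ← ih, ← h.measure_fst]
    exact F.measure_congr fun t => Function.iterate_succ_apply' f n (γ t)

theorem Stretches.measure_snd_iterate (h : Stretches f F G c) {x y : S} (γ : Path x y) (n : ℕ) :
    G.measure (γ.map (f.continuous.iterate n)) = ((c⁻¹ : ℝ≥0) : ℝ≥0∞) ^ n * G.measure γ := by
  induction n with
  | zero => rw [pow_zero, one_mul]; exact G.measure_congr fun t => rfl
  | succ n ih =>
    rw [pow_succ', mul_assoc, ← ih, ← h.measure_snd]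
    exact G.measure_congr fun t => Function.iterate_succ_apply' f n (γ t)

theorem Stretches.iterate_mem_leaf (h : Stretches f F G c) {x y : S} (n : ℕ)
    (hy : y ∈ F.leaf x) : f^[n] y ∈ F.leaf (f^[n] x) := by
  obtain ⟨γ, hγ⟩ := hy
  exact ⟨γ.map (f.continuous.iterate n), by rw [h.measure_fst_iterate, hγ, mul_zero]⟩

theorem pathVariation_const_mul (a : ℝ≥0) (u : S → ℝ) {x y : S} (γ : Path x y) :
    pathVariation (fun q => (a : ℝ) * u q) γ = a * pathVariation u γ := by
  have h : ∀ s t : unitInterval,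
      edist ((a : ℝ) * u (γ s)) ((a : ℝ) * u (γ t)) = a * edist (u (γ s)) (u (γ t)) := by
    intro s t
    rw [edist_dist, edist_dist, Real.dist_eq, Real.dist_eq, ← mul_sub, abs_mul,
      NNReal.abs_eq, ENNReal.ofReal_mul a.coe_nonneg, ENNReal.ofReal_coe_nnreal]
  simp only [pathVariation, eVariationOn, h, ← Finset.mul_sum, ENNReal.mul_iSup]

theorem MonotoneAlong.const_mul {u : S → ℝ} {x y : S} {γ : Path x y} (h : MonotoneAlong u γ)
    {a : ℝ} (ha : 0 ≤ a) : MonotoneAlong (fun q => a * u q) γ := by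
  rcases h with h | h
  · exact Or.inl fun s t hst => mul_le_mul_of_nonneg_left (h hst) ha
  · exact Or.inr fun s t hst => mul_le_mul_of_nonneg_left (h hst) ha

/-- The pullback of a height function, rescaled, is a height function. -/
theorem Stretches.isHeight_preimage (h : Stretches f F G c) {O : Set S} {u : S → ℝ}
    (hu : IsHeight F O u) :
    IsHeight F (f ⁻¹' O) (fun q => ((c⁻¹ : ℝ≥0) : ℝ) * u (f q)) := by
  have hc : (0 : ℝ) < (c⁻¹ : ℝ≥0) := by exact_mod_cast inv_pos.2 h.pos
  have pull : ∀ {a b a' b' : S} (γ : Path a b) (W : Set S) (ha : f a' = a) (hb : f b' = b),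
      range γ ⊆ f.symm ⁻¹' W → MonotoneAlong u γ → ∃ δ : Path a' b', range δ ⊆ W ∧
        MonotoneAlong (fun q => ((c⁻¹ : ℝ≥0) : ℝ) * u (f q)) δ := by
    rintro _ _ a' b' γ W rfl rfl hγ hm
    refine ⟨(γ.map f.symm.continuous).cast (by simp) (by simp), ?_, ?_⟩
    · rintro _ ⟨t, rfl⟩
      exact hγ (mem_range_self t)
    · refine MonotoneAlong.const_mul (u := fun q => u (f q)) ?_ hc.le
      simpa [MonotoneAlong] using hm
  have hnhds : ∀ {x : S} {W : Set S}, W ∈ 𝓝 x → f.symm ⁻¹' W ∈ 𝓝 (f x) := fun {x W} hW =>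
    f.symm.continuous.continuousAt.preimage_mem_nhds (by rwa [f.symm_apply_apply])
  refine ⟨hu.isOpen.preimage f.continuous, ?_, fun q => mul_nonneg hc.le (hu.nonneg _),
    fun γ hγ => ?_, fun x hx W hW => ?_, fun x hx hpos W hW => ?_, fun x hx hpos => ?_⟩
  · exact continuousOn_const.mul (hu.continuousOn.comp f.continuous.continuousOn
      (mapsTo_preimage f O))
  · have h1 := hu.measure_eq (γ.map f.continuous) (by
      rintro _ ⟨t, rfl⟩
      exact hγ (mem_range_self t))
    rw [h.measure_fst] at h1
    have h2 := pathVariation_const_mul c⁻¹ (fun q => u (f q)) γ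
    have h3 : pathVariation (fun q => u (f q)) γ = pathVariation u (γ.map f.continuous) := rfl
    rw [h2, h3, ← h1, ← mul_assoc, ← ENNReal.coe_mul, inv_mul_cancel₀ h.pos.ne',
      ENNReal.coe_one, one_mul]
  · obtain ⟨N, hN, hpath⟩ := hu.exists_path (f x) hx _ (hnhds hW)
    refine ⟨f ⁻¹' N, f.continuous.continuousAt.preimage_mem_nhds hN, fun y hy => ?_⟩
    obtain ⟨γ, hγ, hm⟩ := hpath (f y) hy
    exact pull γ W rfl rfl hγ hm
  · obtain ⟨N, hN, hpath⟩ := hu.exists_path_of_pos (f x) hx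
      (pos_of_mul_pos_right hpos hc.le) _ (hnhds hW)
    refine ⟨f ⁻¹' N, f.continuous.continuousAt.preimage_mem_nhds hN, fun y hy y' hy' => ?_⟩
    obtain ⟨γ, hγ, hm⟩ := hpath (f y) hy (f y') hy'
    exact pull γ W rfl rfl hγ hm
  · have h1 := hu.frequently_ne (f x) hx (pos_of_mul_pos_right hpos hc.le)
    have h2 : Tendsto f.symm (𝓝 (f x)) (𝓝 x) := by
      simpa using (f.symm.continuous.tendsto (f x))
    refine h2.frequently (h1.mono fun z hz => ?_)
    rw [f.apply_symm_apply]
    exact fun he => hz (mul_left_cancel₀ hc.ne' he)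

theorem Stretches.isHeight_iterate (h : Stretches f F G c) {O : Set S} {u : S → ℝ}
    (hu : IsHeight F O u) (n : ℕ) :
    IsHeight F (f^[n] ⁻¹' O) (fun q => ((c⁻¹ : ℝ≥0) : ℝ) ^ n * u (f^[n] q)) := by
  induction n with
  | zero => simpa using hu
  | succ n ih =>
    have := h.isHeight_preimage ih
    simp only [← mul_assoc, ← pow_succ'] at this
    exact this

/-- The forward images of the path `γ` under `f` become arbitrarily small: for every choice of
neighbourhoods of the points, they are eventually contained in one of them. -/
def Shrinks {x y : S} (f : S → S) (γ : Path x y) : Prop :=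
  ∀ O : S → Set S, (∀ p, O p ∈ 𝓝 p) → ∀ᶠ n in atTop, ∃ p, ∀ t, f^[n] (γ t) ∈ O p

/-- A path whose forward images become small has measure zero. Otherwise the height in a chart is
not constant along some image. But its later images have heights bounded by `1`, hence, pulled back,
by arbitrarily small constants. -/
theorem Stretches.measure_eq_zero_of_shrinks (h : Stretches f F G c) {x y : S} {γ : Path x y}
    (hγ : Shrinks f γ) : F.measure γ = 0 := by
  choose φ hφ hφ0 hchart using h.transverse.exists_isFoliatedChart
  set u : S → S → ℝ := fun p q => prongHeight (F.prongs p) (φ p q) with hu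
  have hup : ∀ p, IsHeight F (φ p).source (u p) := fun p => (hchart p).isHeight
  have hO : ∀ p, (φ p).source ∩ u p ⁻¹' Iio 1 ∈ 𝓝 p := fun p => by
    refine inter_mem ((φ p).open_source.mem_nhds (hφ p)) ?_
    refine ((hup p).continuousOn.continuousAt
      ((φ p).open_source.mem_nhds (hφ p))).preimage_mem_nhds (Iio_mem_nhds ?_)
    have hk := F.one_le_prongs p
    simp [hu, hφ0, prongHeight, show F.prongs p ≠ 0 by omega]
  obtain ⟨N, hN⟩ := eventually_atTop.1 (hγ _ hO)
  obtain ⟨p, hp⟩ := hN N le_rfl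
  set δ := γ.map (f.continuous.iterate N) with hδ
  have hδp : range δ ⊆ (φ p).source := by
    rintro _ ⟨t, rfl⟩
    exact (hp t).1
  have hconst : ∀ s t, u p (δ s) = u p (δ t) := by
    intro s t
    have hbound : ∀ m : ℕ, |u p (δ s) - u p (δ t)| ≤ 2 * ((c⁻¹ : ℝ≥0) : ℝ) ^ m := by
      intro m
      obtain ⟨q, hq⟩ := hN (N + m) (Nat.le_add_right N m)
      have e : ∀ t, f^[m] (δ t) = f^[N + m] (γ t) := fun t => by
        rw [add_comm, Function.iterate_add_apply]; rfl
      refine (hup p).abs_sub_le_two_mul (h.isHeight_iterate (hup q) m) δ hδp ?_ ?_ s t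
      · rintro _ ⟨t, rfl⟩
        change f^[m] (δ t) ∈ (φ q).source
        rw [e]; exact (hq t).1
      · intro s t
        simp only [e]
        have h1 : u q (f^[N + m] (γ s)) < 1 := (hq s).2
        have h2 : u q (f^[N + m] (γ t)) < 1 := (hq t).2
        have h3 := (hup q).nonneg (f^[N + m] (γ s))
        have h4 := (hup q).nonneg (f^[N + m] (γ t))
        rw [← mul_sub, abs_mul, abs_of_nonneg (by positivity)]
        refine mul_le_of_le_one_right (by positivity) (abs_le.2 ⟨by linarith, by linarith⟩)
    have hlim : Tendsto (fun m : ℕ => 2 * ((c⁻¹ : ℝ≥0) : ℝ) ^ m) atTop (𝓝 (2 * 0)) :=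
      (tendsto_pow_atTop_nhds_zero_of_lt_one (NNReal.coe_nonneg _)
        (by exact_mod_cast inv_lt_one_of_one_lt₀ h.one_lt)).const_mul 2
    have h0 := ge_of_tendsto' hlim hbound
    rw [mul_zero] at h0
    exact sub_eq_zero.1 (abs_eq_zero.1 (le_antisymm h0 (abs_nonneg _)))
  have hz : F.measure δ = 0 := by
    rw [(hup p).measure_eq δ hδp, pathVariation_eq_zero_iff]
    exact hconst
  rw [hδ, h.measure_fst_iterate] at hz
  refine (mul_eq_zero.1 hz).resolve_left ?_
  exact pow_ne_zero _ (ENNReal.coe_ne_zero.2 h.pos.ne')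

/-- A path in a leaf of `F` can be replaced by a path in this leaf which has finite length for the
transverse measure of `G`. -/
theorem exists_path_measure_ne_top (h : F.Transverse G) {x y : S} (γ : Path x y)
    (hγ : F.measure γ = 0) : ∃ δ : Path x y, F.measure δ = 0 ∧ G.measure δ ≠ ⊤ := by
  choose φ hφ hφ0 hchart using h.exists_isFoliatedChart
  refine Path.induction_on_cover (U := fun p => (φ p).source) (fun p => (φ p).open_source)
    (eq_univ_of_forall fun p => mem_iUnion.2 ⟨p, hφ p⟩)
    (P := fun x y γ => F.measure γ = 0 → ∃ δ : Path x y, F.measure δ = 0 ∧ G.measure δ ≠ ⊤)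
    ?_ ?_ γ hγ
  · intro x y γ p hγp hγ
    rw [(hchart p).measure_fst γ hγp, pathVariation_eq_zero_iff] at hγ
    have hsmall : ∀ {a b : S} (δ : Path a b), range δ ⊆ (φ p).source →
        MonotoneAlong (fun q => prongHeight (F.prongs p) (φ p q)) δ →
        MonotoneAlong (fun q => prongWidth (F.prongs p) (φ p q)) δ →
        prongHeight (F.prongs p) (φ p b) = prongHeight (F.prongs p) (φ p a) →
        F.measure δ = 0 ∧ G.measure δ ≠ ⊤ := by
      intro a b δ hδ h1 h2 he
      rw [(hchart p).measure_fst δ hδ, (hchart p).measure_snd δ hδ]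
      refine ⟨le_antisymm (h1.pathVariation_le.trans ?_) zero_le,
        ne_top_of_le_ne_top ENNReal.ofReal_ne_top h2.pathVariation_le⟩
      rw [he, sub_self, abs_zero, ENNReal.ofReal_zero]
    have key := isPreconnected_univ.induction₂ (s := (univ : Set unitInterval))
      (fun a b => (∃ δ : Path (γ a) (γ b), F.measure δ = 0 ∧ G.measure δ ≠ ⊤) ∧
        ∃ δ : Path (γ b) (γ a), F.measure δ = 0 ∧ G.measure δ ≠ ⊤)
      (fun a _ => ?_) ?_ (fun _ _ _ _ => And.symm) (mem_univ 0) (mem_univ 1)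
    · obtain ⟨⟨δ, hδ⟩, -⟩ := key
      have e : ∀ F : MeasuredFoliation S,
          F.measure (δ.cast γ.source.symm γ.target.symm) = F.measure δ :=
        fun F => F.measure_congr fun _ => rfl
      exact ⟨δ.cast γ.source.symm γ.target.symm, by rwa [e F, e G]⟩
    · have ha : γ a ∈ (φ p).source := hγp (mem_range_self a)
      obtain ⟨N, hN, hpath⟩ := (hchart p).exists_path ha ((φ p).open_source.mem_nhds ha)
      refine nhdsWithin_le_nhds ?_
      filter_upwards [γ.continuous.continuousAt.preimage_mem_nhds hN] with b hb
      obtain ⟨δ, hδ, h1, h2⟩ := hpath _ hb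
      refine ⟨⟨δ, hsmall δ hδ h1 h2 (hγ _ _)⟩, ⟨δ.symm, hsmall δ.symm ?_ h1.symm h2.symm (hγ _ _)⟩⟩
      rwa [Path.symm_range]
    · rintro a b c - - - ⟨⟨δ, h1, h2⟩, ⟨δ', h1', h2'⟩⟩ ⟨⟨ε, h3, h4⟩, ⟨ε', h3', h4'⟩⟩
      refine ⟨⟨δ.trans ε, ?_, ?_⟩, ⟨ε'.trans δ', ?_, ?_⟩⟩ <;>
        rw [MeasuredFoliation.measure_trans]
      · rw [h1, h3, add_zero]
      · exact ENNReal.add_ne_top.2 ⟨h2, h4⟩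
      · rw [h1', h3', add_zero]
      · exact ENNReal.add_ne_top.2 ⟨h4', h2'⟩
  · intro x y z γ δ h1 h2 h0
    rw [F.measure_trans, add_eq_zero] at h0
    obtain ⟨γ', h3, h4⟩ := h1 h0.1
    obtain ⟨δ', h5, h6⟩ := h2 h0.2
    refine ⟨γ'.trans δ', ?_, ?_⟩
    · rw [F.measure_trans, h3, h5, add_zero]
    · rw [G.measure_trans]; exact ENNReal.add_ne_top.2 ⟨h4, h6⟩

/-- Near `p`, a path of small total measure for both foliations stays close to `p`: it cannot leave
a box around `p`. -/
theorem exists_small_of_measure_lt [T2Space S] (h : F.Transverse G) {p : S} {V : Set S}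
    (hV : V ∈ 𝓝 p) : ∃ ε > (0 : ℝ≥0∞), ∃ N ∈ 𝓝 p, ∀ {x y : S} (γ : Path x y), x ∈ N →
      F.measure γ < ε → G.measure γ < ε → range γ ⊆ V := by
  obtain ⟨φ, hp, h0, hchart⟩ := h.exists_isFoliatedChart p
  set k := F.prongs p
  obtain ⟨ρ, hρ, hball⟩ := Metric.nhds_basis_closedBall.mem_iff.1
    (φ.target_inter_preimage_mem_nhds hp hV)
  rw [h0] at hball
  set K := φ.symm '' Metric.closedBall 0 ρ with hK
  have hKc : IsClosed K := ((isCompact_closedBall _ _).image_of_continuousOn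
    (φ.continuousOn_symm.mono fun z hz => (hball hz).1)).isClosed
  have hKV : K ⊆ V := by
    rintro _ ⟨z, hz, rfl⟩; exact (hball hz).2
  -- The height and the width satisfy `u ^ 2 + w ^ 2 = ‖φ q‖ ^ k`, so both being less than `R`
  -- means that `q` lies in `K`.
  set R := Real.sqrt (ρ ^ k / 2)
  have hR : 0 < R := Real.sqrt_pos.2 (by positivity)
  set u : S → ℝ := fun q => prongHeight k (φ q) with hu
  set w : S → ℝ := fun q => prongWidth k (φ q) with hw
  have hu0 : ∀ q, 0 ≤ u q := fun q => prongHeight_nonneg k _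
  have hw0 : ∀ q, 0 ≤ w q := fun q => prongWidth_nonneg k _
  have hbox : ∀ q ∈ φ.source, u q < R → w q < R → q ∈ K := by
    intro q hq h1 h2
    refine ⟨φ q, ?_, φ.left_inv hq⟩
    rw [mem_closedBall_zero_iff]
    have h3 : u q ^ 2 < ρ ^ k / 2 := (Real.lt_sqrt (hu0 q)).1 h1
    have h4 : w q ^ 2 < ρ ^ k / 2 := (Real.lt_sqrt (hw0 q)).1 h2
    have h5 : ‖φ q‖ ^ k = u q ^ 2 + w q ^ 2 := norm_pow_eq_prong k (φ q)
    exact (lt_of_pow_lt_pow_left₀ k hρ.le (by rw [h5]; linarith)).le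
  have hstay : ∀ {x y : S} (γ : Path x y), x ∈ K →
      ENNReal.ofReal (u x) + F.measure γ < ENNReal.ofReal R →
      ENNReal.ofReal (w x) + G.measure γ < ENNReal.ofReal R →
      range γ ⊆ K ∧ ENNReal.ofReal (u y) ≤ ENNReal.ofReal (u x) + F.measure γ ∧
        ENNReal.ofReal (w y) ≤ ENNReal.ofReal (w x) + G.measure γ := by
    intro x y γ
    refine Path.induction_on_cover (U := fun b : Bool => cond b φ.source Kᶜ)
      (fun b => ?_) ?_ (P := fun x y γ => x ∈ K →
        ENNReal.ofReal (u x) + F.measure γ < ENNReal.ofReal R →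
        ENNReal.ofReal (w x) + G.measure γ < ENNReal.ofReal R →
        range γ ⊆ K ∧ ENNReal.ofReal (u y) ≤ ENNReal.ofReal (u x) + F.measure γ ∧
          ENNReal.ofReal (w y) ≤ ENNReal.ofReal (w x) + G.measure γ) ?_ ?_ γ
    · cases b
      · exact hKc.isOpen_compl
      · exact φ.open_source
    · refine eq_univ_of_forall fun q => mem_iUnion.2 ?_
      by_cases hq : q ∈ K
      · obtain ⟨z, hz, rfl⟩ := hq
        exact ⟨true, φ.map_target (hball hz).1⟩
      · exact ⟨false, hq⟩
    · rintro x y γ (_ | _) hγ hx h1 h2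
      · exact absurd hx (hγ ⟨0, γ.source⟩)
      have hγ : range γ ⊆ φ.source := hγ
      have key : ∀ v : S → ℝ, ∀ t, ENNReal.ofReal (v (γ t)) ≤
          ENNReal.ofReal (v x) + pathVariation v γ := by
        intro v t
        have h3 := ofReal_abs_sub_le_pathVariation v γ t 0
        rw [γ.source] at h3
        have h4 : v (γ t) ≤ v x + |v (γ t) - v x| := by linarith [le_abs_self (v (γ t) - v x)]
        exact (ENNReal.ofReal_le_ofReal h4).trans
          (ENNReal.ofReal_add_le.trans (by gcongr))
      have hF := key u
      have hG := key w
      rw [← hchart.measure_fst γ hγ] at hF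
      rw [← hchart.measure_snd γ hγ] at hG
      refine ⟨?_, by simpa using hF 1, by simpa using hG 1⟩
      rintro _ ⟨t, rfl⟩
      refine hbox _ (hγ (mem_range_self t)) ?_ ?_
      · exact (ENNReal.ofReal_lt_ofReal_iff hR).1 ((hF t).trans_lt h1)
      · exact (ENNReal.ofReal_lt_ofReal_iff hR).1 ((hG t).trans_lt h2)
    · intro x y z γ δ hγ hδ hx h1 h2
      rw [F.measure_trans, ← add_assoc] at h1 ⊢
      rw [G.measure_trans, ← add_assoc] at h2 ⊢
      obtain ⟨h3, h4, h5⟩ := hγ hx (le_self_add.trans_lt h1) (le_self_add.trans_lt h2)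
      have h6 : ENNReal.ofReal (u y) + F.measure δ ≤
        ENNReal.ofReal (u x) + F.measure γ + F.measure δ := by gcongr
      have h7 : ENNReal.ofReal (w y) + G.measure δ ≤
        ENNReal.ofReal (w x) + G.measure γ + G.measure δ := by gcongr
      obtain ⟨h8, h9, h10⟩ := hδ (h3 ⟨1, γ.target⟩) (h6.trans_lt h1) (h7.trans_lt h2)
      exact ⟨by rw [Path.trans_range]; exact union_subset h3 h8, h9.trans h6, h10.trans h7⟩
  have hk : k ≠ 0 := by have := hchart.one_le; omega
  have hup : u p = 0 := by simp [hu, h0, prongHeight, hk]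
  have hwp : w p = 0 := by simp [hw, h0, prongWidth, hk]
  have hsrc := φ.open_source.mem_nhds hp
  refine ⟨ENNReal.ofReal (R / 2), ENNReal.ofReal_pos.2 (half_pos hR),
    φ.source ∩ (u ⁻¹' Iio (R / 2) ∩ w ⁻¹' Iio (R / 2)), inter_mem hsrc (inter_mem ?_ ?_), ?_⟩
  · exact (hchart.isHeight.continuousOn.continuousAt hsrc).preimage_mem_nhds
      (Iio_mem_nhds (hup.trans_lt (half_pos hR)))
  · exact (hchart.isHeight_snd.continuousOn.continuousAt hsrc).preimage_mem_nhds
      (Iio_mem_nhds (hwp.trans_lt (half_pos hR)))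
  · rintro x y γ ⟨hx, hux, hwx⟩ h1 h2
    have hux : u x < R / 2 := hux
    have hwx : w x < R / 2 := hwx
    have hlt : ∀ a : ℝ, 0 ≤ a → a < R / 2 → ∀ m : ℝ≥0∞, m < ENNReal.ofReal (R / 2) →
        ENNReal.ofReal a + m < ENNReal.ofReal R := by
      intro a ha haR m hm
      have e : ENNReal.ofReal R = ENNReal.ofReal (R / 2) + ENNReal.ofReal (R / 2) := by
        rw [← ENNReal.ofReal_add (by positivity) (by positivity), add_halves]
      rw [e]
      exact ENNReal.add_lt_add ((ENNReal.ofReal_lt_ofReal_iff (half_pos hR)).2 haR) hm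
    exact (hstay γ (hbox x hx (by linarith) (by linarith)) (hlt _ (hu0 x) hux _ h1)
      (hlt _ (hw0 x) hwx _ h2)).1.trans hKV

/-- By compactness, the bound which makes a path small can be chosen uniformly. -/
theorem exists_measure_bound [T2Space S] [CompactSpace S] (h : F.Transverse G) {O : S → Set S}
    (hO : ∀ p, O p ∈ 𝓝 p) : ∃ ε > (0 : ℝ≥0∞), ∀ {x y : S} (γ : Path x y),
      F.measure γ < ε → G.measure γ < ε → ∃ p, ∀ t, γ t ∈ O p := by
  choose ε hε N hN hsmall using fun p => exists_small_of_measure_lt h (hO p)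
  obtain ⟨P, -, hP⟩ := isCompact_univ.elim_nhds_subcover N fun p _ => hN p
  refine ⟨P.inf ε, (Finset.lt_inf_iff ENNReal.zero_lt_top).2 fun p _ => hε p,
    fun {x y} γ h1 h2 => ?_⟩
  obtain ⟨p, hp, hx⟩ := mem_iUnion₂.1 (hP (mem_univ x))
  have h3 := Finset.inf_le (f := ε) hp
  exact ⟨p, fun t => hsmall p γ hx (h1.trans_le h3) (h2.trans_le h3) (mem_range_self t)⟩

theorem Stretches.exists_shrinks [T2Space S] [CompactSpace S] (h : Stretches f F G c) {x y : S}
    (hy : y ∈ F.leaf x) : ∃ γ : Path x y, Shrinks f γ := by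
  obtain ⟨γ₀, hγ₀⟩ := hy
  obtain ⟨γ, hF, hG⟩ := exists_path_measure_ne_top h.transverse γ₀ hγ₀
  refine ⟨γ, fun O hO => ?_⟩
  obtain ⟨ε, hε, hsmall⟩ := exists_measure_bound h.transverse hO
  have hc : ((c⁻¹ : ℝ≥0) : ℝ≥0∞) < 1 := by exact_mod_cast inv_lt_one_of_one_lt₀ h.one_lt
  have hlim : Tendsto (fun n : ℕ => ((c⁻¹ : ℝ≥0) : ℝ≥0∞) ^ n * G.measure γ) atTop (𝓝 0) := by
    simpa using ENNReal.Tendsto.mul_const (ENNReal.tendsto_pow_atTop_nhds_zero_of_lt_one hc)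
      (Or.inr hG)
  filter_upwards [hlim.eventually (gt_mem_nhds hε)] with n hn
  refine hsmall (γ.map (f.continuous.iterate n)) ?_ ?_
  · rwa [h.measure_fst_iterate, hF, mul_zero]
  · rwa [h.measure_snd_iterate]

/-- The dynamical characterization of the leaves of `F`. The path cannot be dispensed with: in the
presence of `1`-prongs, points on different leaves can have asymptotic forward orbits. -/
theorem Stretches.mem_leaf_iff [T2Space S] [CompactSpace S] (h : Stretches f F G c) {x y : S} :
    y ∈ F.leaf x ↔ ∃ γ : Path x y, Shrinks f γ :=
  ⟨h.exists_shrinks, fun ⟨γ, hγ⟩ => ⟨γ, h.measure_eq_zero_of_shrinks hγ⟩⟩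

theorem Shrinks.map {S' : Type*} [TopologicalSpace S'] {g : S' → S'} {f : S → S} (h : S ≃ₜ S')
    (hconj : ∀ x, g (h x) = h (f x)) {x y : S} {γ : Path x y} (hγ : Shrinks f γ) :
    Shrinks g (γ.map h.continuous) := by
  intro O hO
  filter_upwards [hγ (fun p => h ⁻¹' O (h p))
    fun p => h.continuous.continuousAt.preimage_mem_nhds (hO _)] with n ⟨p, hp⟩
  refine ⟨h p, fun t => ?_⟩
  have e : g^[n] (h (γ t)) = h (f^[n] (γ t)) :=
    ((show Function.Semiconj h f g from fun x => (hconj x).symm).iterate_right n (γ t)).symm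
  change g^[n] (h (γ t)) ∈ _
  rw [e]
  exact hp t

/-! ### Leaves of transverse foliations -/

/-- A leaf meets a chart in countably many plaques. -/
theorem Stretches.countable_image_leaf [T2Space S] [CompactSpace S] [SecondCountableTopology S]
    (h : Stretches f F G c) {O : Set S} {u : S → ℝ} (hu : IsHeight F O u) (x : S) :
    (u '' (F.leaf x ∩ O)).Countable := by
  choose φ hφ hφ0 hchart using h.transverse.exists_isFoliatedChart
  set v : S → S → ℝ := fun p q => prongHeight (F.prongs p) (φ p q)
  have hv : ∀ p, IsHeight F (φ p).source (v p) := fun p => (hchart p).isHeight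
  obtain ⟨P, -, hP⟩ := isCompact_univ.elim_nhds_subcover (fun p => (φ p).source)
    fun p _ => (φ p).open_source.mem_nhds (hφ p)
  -- After sufficiently many iterations, the points of the leaf lie in the plaque of `x`.
  have hcov : F.leaf x ∩ O ⊆ ⋃ n : ℕ, ⋃ p ∈ P,
      {y ∈ O ∩ f^[n] ⁻¹' (φ p).source | v p (f^[n] y) = v p (f^[n] x)} := by
    rintro y ⟨hy, hyO⟩
    obtain ⟨γ, hγ⟩ := h.exists_shrinks hy
    choose r hrP hr using fun q => mem_iUnion₂.1 (hP (mem_univ q))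
    obtain ⟨n, hn⟩ := (hγ (fun q => (φ (r q)).source)
      fun q => (φ (r q)).open_source.mem_nhds (hr q)).exists
    obtain ⟨q, hq⟩ := hn
    refine mem_iUnion.2 ⟨n, mem_iUnion₂.2 ⟨r q, hrP q, ⟨hyO, by simpa using hq 1⟩, ?_⟩⟩
    have h1 := h.measure_fst_iterate γ n
    rw [h.measure_eq_zero_of_shrinks hγ, mul_zero, (hv (r q)).measure_eq _ (by
      rintro _ ⟨t, rfl⟩; exact hq t), pathVariation_eq_zero_iff] at h1
    simpa using h1 1 0
  refine Countable.mono (image_mono hcov) ?_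
  simp only [image_iUnion]
  refine countable_iUnion fun n => P.countable_toSet.biUnion fun p _ => ?_
  set A := {y ∈ O ∩ f^[n] ⁻¹' (φ p).source | v p (f^[n] y) = v p (f^[n] x)} with hA
  -- On a level set of the pulled back height, the height `u` is locally constant.
  have hloc : ∀ y ∈ A, {z | u z = u y} ∈ 𝓝[A] y := by
    rintro y ⟨⟨hyO, hyp⟩, hy⟩
    have h1 := hu.eventually_abs_sub_eq (h.isHeight_iterate (hv p) n) hyO hyp
    filter_upwards [nhdsWithin_le_nhds h1, self_mem_nhdsWithin] with z hz hzA
    rw [hzA.2, hy, sub_self, abs_zero, abs_eq_zero, sub_eq_zero] at hz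
    exact hz
  obtain ⟨t, -, htc, ht⟩ := TopologicalSpace.countable_cover_nhdsWithin hloc
  refine (htc.image u).mono ?_
  rintro _ ⟨y, hy, rfl⟩
  obtain ⟨z, hz, hyz⟩ := mem_iUnion₂.1 (ht hy)
  exact ⟨z, hz, hyz.symm⟩

/-- An arc cannot be contained both in a leaf of `F` and in a leaf of `G`. -/
theorem not_injOn_of_mapsTo_leaf [T2Space S] [CompactSpace S] [SecondCountableTopology S]
    {f' : S ≃ₜ S} {c' : ℝ≥0} (h : Stretches f F G c) (h' : Stretches f' G F c') {J : ℝ → S}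
    (hJ : ContinuousOn J (Ioo 0 1)) {x y : S} (hx : MapsTo J (Ioo 0 1) (F.leaf x))
    (hy : MapsTo J (Ioo 0 1) (G.leaf y)) : ¬ InjOn J (Ioo 0 1) := by
  intro hinj
  have hmid : (1 / 2 : ℝ) ∈ Ioo (0 : ℝ) 1 := by constructor <;> norm_num
  obtain ⟨φ, hp, -, hchart⟩ := h.transverse.exists_isFoliatedChart (J (1 / 2))
  have hnhds : Ioo (0 : ℝ) 1 ∩ J ⁻¹' φ.source ∈ 𝓝 (1 / 2 : ℝ) :=
    inter_mem (Ioo_mem_nhds hmid.1 hmid.2) ((hJ.continuousAt (Ioo_mem_nhds hmid.1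
      hmid.2)).preimage_mem_nhds (φ.open_source.mem_nhds hp))
  obtain ⟨r, hr, hball⟩ := Metric.mem_nhds_iff.1 hnhds
  set I := Metric.ball (1 / 2 : ℝ) r
  have hI : IsPreconnected I := (convex_ball _ _).isPreconnected
  have hJI : ContinuousOn J I := hJ.mono fun t ht => (hball ht).1
  have hJs : MapsTo J I φ.source := fun t ht => (hball ht).2
  have hconst : ∀ {F₁ F₂ : MeasuredFoliation S} {f₁ : S ≃ₜ S} {c₁ : ℝ≥0} {u : S → ℝ} {z : S},
      Stretches f₁ F₁ F₂ c₁ → IsHeight F₁ φ.source u → MapsTo J (Ioo 0 1) (F₁.leaf z) →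
      ∀ t ∈ I, u (J t) = u (J (1 / 2)) := by
    intro F₁ F₂ f₁ c₁ u z h₁ hu hz t ht
    have h1 : IsPreconnected ((u ∘ J) '' I) :=
      hI.image _ (hu.continuousOn.comp hJI hJs)
    have h2 : ((u ∘ J) '' I).Countable := by
      refine (h₁.countable_image_leaf hu z).mono ?_
      rintro _ ⟨s, hs, rfl⟩
      exact ⟨J s, ⟨hz (hball hs).1, hJs hs⟩, rfl⟩
    exact h2.isTotallyDisconnected _ subset_rfl h1 (mem_image_of_mem _ ht)
      (mem_image_of_mem _ (Metric.mem_ball_self hr))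
  have hF := hconst h hchart.isHeight hx
  have hG := hconst h' hchart.isHeight_snd hy
  have h1 : IsPreconnected ((φ ∘ J) '' I) := hI.image _ (φ.continuousOn.comp hJI hJs)
  have h2 : ((φ ∘ J) '' I).Countable := by
    have hfin := finite_setOf_prongHeight_eq hchart.one_le
      (prongHeight (F.prongs (J (1 / 2))) (φ (J (1 / 2))))
      (prongWidth (F.prongs (J (1 / 2))) (φ (J (1 / 2))))
    refine hfin.countable.mono ?_
    rintro _ ⟨s, hs, rfl⟩
    exact ⟨hF s hs, hG s hs⟩
  have hmem : (1 / 2 + r / 2 : ℝ) ∈ I := by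
    rw [Metric.mem_ball, Real.dist_eq, add_sub_cancel_left, abs_of_pos (half_pos hr)]
    exact half_lt_self hr
  have h3 := h2.isTotallyDisconnected _ subset_rfl h1 (mem_image_of_mem _ hmem)
    (mem_image_of_mem _ (Metric.mem_ball_self hr))
  have h4 := φ.injOn (hJs hmem) hp h3
  have h5 := hinj (hball hmem).1 hmid h4
  linarith

end Leaves

theorem IsPseudoAnosov.exists_stretches {S : Type*} [TopologicalSpace S] [OrientedSurface S]
    {f : S ≃ₜ S} {Fs Fu : MeasuredFoliation S} (hf : IsPseudoAnosov f Fs Fu) :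
    ∃ c : ℝ≥0, Stretches f Fs Fu c ∧ Stretches f.symm Fu Fs c := by
  obtain ⟨-, ht, c, hc, hu, hs⟩ := hf
  have hc0 : c ≠ 0 := (zero_lt_one.trans hc).ne'
  have back : ∀ (F : MeasuredFoliation S) (a : ℝ≥0), a ≠ 0 →
      (∀ {x y : S} (γ : Path x y), F.measure (γ.map f.symm.continuous) = a * F.measure γ) →
      ∀ {x y : S} (γ : Path x y), F.measure (γ.map f.continuous) = (a⁻¹ : ℝ≥0) * F.measure γ := by
    intro F a ha h x y γ
    have h1 := h (γ.map f.continuous)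
    rw [F.measure_congr (γ' := γ) (fun t => f.symm_apply_apply (γ t))] at h1
    rw [h1, ← mul_assoc, ← ENNReal.coe_mul, inv_mul_cancel₀ ha, ENNReal.coe_one, one_mul]
  refine ⟨c, ⟨hc, ht, ?_, ?_⟩, ⟨hc, ht.symm, hu.2, hs.2⟩⟩
  · intro x y γ
    have := back Fs c⁻¹ (inv_ne_zero hc0) hs.2 γ
    rwa [inv_inv] at this
  · exact back Fu c hc0 hu.2

/-! ### Orientations -/

theorem eq_of_forall_exp_eq_one {X : Type*} [TopologicalSpace X] [PreconnectedSpace X] {D : X → ℂ}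
    (hD : Continuous D) (h : ∀ x, Complex.exp (D x) = 1) (x y : X) : D x = D y := by
  have h1 : (range D).Countable := by
    refine (countable_range fun n : ℤ => (n : ℂ) * (2 * Real.pi * Complex.I)).mono ?_
    rintro _ ⟨x, rfl⟩
    obtain ⟨n, hn⟩ := Complex.exp_eq_one_iff.1 (h x)
    exact ⟨n, hn.symm⟩
  exact h1.isTotallyDisconnected _ subset_rfl (isPreconnected_range hD) (mem_range_self x)
    (mem_range_self y)

theorem PreservesOrientationAt.congr {φ ψ : ℂ → ℂ} {z : ℂ} (h : PreservesOrientationAt φ z)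
    (he : φ =ᶠ[𝓝 z] ψ) : PreservesOrientationAt ψ z := by
  obtain ⟨δ, hδ, hball⟩ := Metric.mem_nhds_iff.1 he
  filter_upwards [h, Ioo_mem_nhdsGT hδ] with r ⟨L, hL, hexp, hper⟩ hr
  refine ⟨L, hL, fun t => ?_, hper⟩
  have h1 : φ (z + r * Complex.exp (t * Complex.I)) = ψ (z + r * Complex.exp (t * Complex.I)) := by
    refine hball ?_
    rw [Metric.mem_ball, dist_self_add_left, norm_mul, Complex.norm_exp_ofReal_mul_I, mul_one,
      Complex.norm_real, Real.norm_of_nonneg hr.1.le]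
    exact hr.2
  rw [← hexp, h1, he.self_of_nhds]

/-- Local degrees multiply. The logarithm of `ψ (φ z + e ^ w) - ψ (φ z)`, which exists on a half
plane, is composed with the logarithm of the loop `φ (z + r e ^ (i t)) - φ z`. -/
theorem PreservesOrientationAt.comp {φ ψ : ℂ → ℂ} {z : ℂ} (hψ : PreservesOrientationAt ψ (φ z))
    (hφ : PreservesOrientationAt φ z) (hφc : ContinuousAt φ z)
    (hψc : ∀ᶠ w in 𝓝 (φ z), ContinuousAt ψ w ∧ (ψ w = ψ (φ z) → w = φ z)) :
    PreservesOrientationAt (ψ ∘ φ) z := by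
  obtain ⟨r₀, hr₀, hball⟩ := Metric.mem_nhds_iff.1 hψc
  let A : Set ℂ := {w | w.re < Real.log r₀}
  have hAconv : Convex ℝ A := convex_halfSpace_re_lt _
  have hAo : IsOpen A := isOpen_lt Complex.continuous_re continuous_const
  have hA : ∀ {w : ℂ}, ‖Complex.exp w‖ < r₀ ↔ w ∈ A := fun {w} => by
    rw [Complex.norm_exp]; exact (Real.lt_log_iff_exp_lt hr₀).symm
  have hne : A.Nonempty := ⟨(Real.log r₀ - 1 : ℝ), by
    change ((Real.log r₀ - 1 : ℝ) : ℂ).re < _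
    rw [Complex.ofReal_re]; linarith⟩
  have : ContractibleSpace A := hAconv.contractibleSpace hne
  have : LocallyPathConnectedSpace A := hAo.locallyPathConnectedSpace
  have hmem : ∀ a : A, φ z + Complex.exp a ∈ Metric.ball (φ z) r₀ := fun a => by
    rw [Metric.mem_ball, dist_self_add_left]; exact hA.2 a.2
  let Φ : C(A, ℂ) :=
    { toFun := fun a => ψ (φ z + Complex.exp a) - ψ (φ z)
      continuous_toFun := by
        refine Continuous.sub (continuous_iff_continuousAt.2 fun a => ?_) continuous_const
        exact ContinuousAt.comp (f := fun a : A => φ z + Complex.exp a) (hball (hmem a)).1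
          (by fun_prop) }
  have hΦ : ∀ a, Φ a ≠ 0 := fun a h0 => by
    have := (hball (hmem a)).2 (sub_eq_zero.1 h0)
    exact Complex.exp_ne_zero _ (left_eq_add.1 this.symm)
  obtain ⟨a₀⟩ := hne.to_subtype
  obtain ⟨M, ⟨-, hM⟩, -⟩ := Complex.isCoveringMapOn_exp.existsUnique_continuousMap_lifts Φ
    (a₀ := a₀) (Complex.exp_log (hΦ a₀)) (fun a => hΦ a)
  have hM : ∀ a, Complex.exp (M a) = Φ a := fun a => congrFun hM a
  have hshift : ∀ a : A, (a : ℂ) + 2 * Real.pi * Complex.I ∈ A := fun a => by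
    have : ((a : ℂ) + 2 * Real.pi * Complex.I).re = (a : ℂ).re := by simp
    change ((a : ℂ) + 2 * Real.pi * Complex.I).re < Real.log r₀
    rw [this]; exact a.2
  let σ : A → A := fun a => ⟨(a : ℂ) + 2 * Real.pi * Complex.I, hshift a⟩
  have hσ : Continuous σ := by fun_prop
  have hΦσ : ∀ a, Φ (σ a) = Φ a := fun a => by
    change ψ (φ z + Complex.exp ((a : ℂ) + 2 * Real.pi * Complex.I)) - _ = _
    rw [Complex.exp_add, Complex.exp_two_pi_mul_I, mul_one]; rfl
  have hconst := eq_of_forall_exp_eq_one (D := fun a => M (σ a) - M a) (by fun_prop)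
    (fun a => by rw [Complex.exp_sub, hM, hM, hΦσ, div_self (hΦ a)])
  have hper : ∀ a, M (σ a) = M a + 2 * Real.pi * Complex.I := by
    obtain ⟨r, ⟨L, hL, hexp, hLper⟩, hr⟩ := (hψ.and (Ioo_mem_nhdsGT hr₀)).exists
    have hlog : ∀ t : ℝ, (Real.log r : ℂ) + t * Complex.I ∈ A := fun t => by
      change ((Real.log r : ℂ) + t * Complex.I).re < _
      simpa using Real.log_lt_log hr.1 hr.2
    let η : ℝ → A := fun t => ⟨(Real.log r : ℂ) + t * Complex.I, hlog t⟩
    have hη : Continuous η := by fun_prop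
    have hΦη : ∀ t, Φ (η t) = Complex.exp (L t) := fun t => by
      rw [← hexp]
      change ψ (φ z + Complex.exp ((Real.log r : ℂ) + t * Complex.I)) - _ = _
      rw [Complex.exp_add, ← Complex.ofReal_exp, Real.exp_log hr.1]
    have h1 := eq_of_forall_exp_eq_one (D := fun t => M (η t) - L t) (by fun_prop)
      (fun t => by rw [Complex.exp_sub, hM, hΦη, div_self (Complex.exp_ne_zero _)])
      (2 * Real.pi) 0
    have h2 : η (2 * Real.pi) = σ (η 0) := by
      ext; simp [η, σ]
    intro a
    have h3 := hconst a (η 0)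
    simp only [h2, hLper] at h1 h3
    linear_combination h3 + h1
  obtain ⟨δ, hδ, hφball⟩ := Metric.mem_nhds_iff.1
    (hφc.preimage_mem_nhds (Metric.ball_mem_nhds _ hr₀))
  filter_upwards [hφ, Ioo_mem_nhdsGT hδ] with r ⟨L, hL, hexp, hLper⟩ hr
  have hLA : ∀ t, L t ∈ A := fun t => by
    rw [← hA, ← hexp, ← dist_eq_norm]
    refine hφball ?_
    rw [Metric.mem_ball, dist_self_add_left, norm_mul, Complex.norm_exp_ofReal_mul_I, mul_one,
      Complex.norm_real, Real.norm_of_nonneg hr.1.le]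
    exact hr.2
  refine ⟨fun t => M ⟨L t, hLA t⟩, by fun_prop, fun t => ?_, ?_⟩
  · rw [hM]
    change _ = ψ (φ z + Complex.exp (L t)) - _
    rw [← hexp, add_sub_cancel]; rfl
  · rw [← hper]
    exact congrArg M (Subtype.ext hLper)

/-! ### Images of rectangles -/

section Images

variable {S S' : Type*} [TopologicalSpace S] [OrientedSurface S]
  [TopologicalSpace S'] [OrientedSurface S'] {Fs Fu : MeasuredFoliation S}
  {Gs Gu : MeasuredFoliation S'}

theorem openSquare_subset_closedSquare : openSquare ⊆ closedSquare :=
  prod_mono Ioo_subset_Icc_self Ioo_subset_Icc_self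

theorem isOpen_openSquare : IsOpen openSquare := isOpen_Ioo.prod isOpen_Ioo

theorem IsParametrization.comp_homeomorph {ρ : ℝ × ℝ → S} {R : Set S}
    (hρ : IsParametrization Fs Fu ρ R) {h : S ≃ₜ S'} (hh : OrientationPreserving h)
    (hs : ∀ x, h '' Fs.leaf x ⊆ Gs.leaf (h x)) (hu : ∀ x, h '' Fu.leaf x ⊆ Gu.leaf (h x)) :
    IsParametrization Gs Gu (fun p => h (ρ p)) (h '' R) where
  continuousOn := h.continuous.comp_continuousOn hρ.continuousOn
  image_eq := by rw [← hρ.image_eq, image_image]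
  isOpenEmbedding := h.isOpenEmbedding.comp hρ.isOpenEmbedding
  orientation z hz e he hze := by
    set e₀ := chartAt ℂ (ρ (z.re, z.im))
    have hz₀ : ρ (z.re, z.im) ∈ e₀.source := mem_chart_source ℂ _
    have hcont : ContinuousAt (fun w : ℂ => ρ (w.re, w.im)) z := by
      have h1 : ContinuousAt ρ (z.re, z.im) := (hρ.continuousOn.mono
        openSquare_subset_closedSquare).continuousAt (isOpen_openSquare.mem_nhds hz)
      exact ContinuousAt.comp (f := fun w : ℂ => (w.re, w.im)) h1 (by fun_prop)
    let E : OpenPartialHomeomorph ℂ ℂ := e₀.symm.trans (h.toOpenPartialHomeomorph.trans e)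
    have hE : e₀ (ρ (z.re, z.im)) ∈ E.source := by
      simp [E, e₀.map_source hz₀, e₀.left_inv hz₀, hze]
    have hψ : PreservesOrientationAt E (e₀ (ρ (z.re, z.im))) :=
      hh e₀ (chart_mem_atlas ℂ _) e he _ hz₀ hze
    have hcomp := PreservesOrientationAt.comp (φ := fun w => e₀ (ρ (w.re, w.im))) hψ
      (hρ.orientation z hz e₀ (chart_mem_atlas ℂ _) hz₀)
      (ContinuousAt.comp (f := fun w : ℂ => ρ (w.re, w.im)) (e₀.continuousAt hz₀) hcont)
      (by
        filter_upwards [E.open_source.mem_nhds hE] with w hw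
        exact ⟨E.continuousAt hw, fun he => E.injOn hw hE he⟩)
    refine hcomp.congr ?_
    filter_upwards [hcont.preimage_mem_nhds (e₀.open_source.mem_nhds hz₀)] with w hw
    change e (h (e₀.symm (e₀ (ρ (w.re, w.im))))) = _
    rw [e₀.left_inv hw]
  horizontal t ht := by
    obtain ⟨⟨x, hx⟩, hemb⟩ := hρ.horizontal t ht
    refine ⟨⟨h x, ?_⟩, h.isEmbedding.comp hemb⟩
    rw [← image_image h ρ]
    exact (image_mono hx).trans (hs x)
  vertical s hst := by
    obtain ⟨⟨x, hx⟩, hemb⟩ := hρ.vertical s hst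
    refine ⟨⟨h x, ?_⟩, h.isEmbedding.comp hemb⟩
    rw [← image_image h ρ]
    exact (image_mono hx).trans (hu x)

theorem Stretches.image_leaf_subset {S S' : Type*} [TopologicalSpace S] [TopologicalSpace S']
    [T2Space S] [CompactSpace S] [T2Space S'] [CompactSpace S'] {F₁ F₂ : MeasuredFoliation S} {G₁ G₂ : MeasuredFoliation S'}
    {f : S ≃ₜ S} {g : S' ≃ₜ S'} {c c' : ℝ≥0} (hf : Stretches f F₁ F₂ c)
    (hg : Stretches g G₁ G₂ c') {h : S ≃ₜ S'} (hconj : ∀ x, g (h x) = h (f x)) (x : S) :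
    h '' F₁.leaf x ⊆ G₁.leaf (h x) := by
  rintro _ ⟨y, hy, rfl⟩
  obtain ⟨γ, hγ⟩ := hf.mem_leaf_iff.1 hy
  exact hg.mem_leaf_iff.2 ⟨γ.map h.continuous, hγ.map h hconj⟩

end Images

/-! ### Bands in a parametrized square -/

section Bands

variable {S : Type*} [TopologicalSpace S] {P Q : ℝ × ℝ → S}

/-- `P` parametrizes a closed topological square, possibly with identifications on the boundary. -/
structure IsSquareParam (P : ℝ × ℝ → S) : Prop where
  continuousOn : ContinuousOn P closedSquare
  isOpenEmbedding : IsOpenEmbedding (openSquare.domRestrict P)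

theorem IsSquareParam.injOn (hP : IsSquareParam P) : InjOn P openSquare :=
  injOn_iff_injective.2 hP.isOpenEmbedding.injective

theorem IsSquareParam.isOpen_image (hP : IsSquareParam P) {A : Set (ℝ × ℝ)} (hA : IsOpen A)
    (hAs : A ⊆ openSquare) : IsOpen (P '' A) := by
  have h := hP.isOpenEmbedding.isOpenMap _ (hA.preimage continuous_subtype_val)
  rwa [show openSquare.domRestrict P '' ((↑) ⁻¹' A) = P '' A from ?_] at h
  ext q
  constructor
  · rintro ⟨a, ha, rfl⟩; exact ⟨a, ha, rfl⟩
  · rintro ⟨a, ha, rfl⟩; exact ⟨⟨a, hAs ha⟩, ha, rfl⟩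

theorem closure_openSquare : closure openSquare = closedSquare := by
  rw [openSquare, closure_prod_eq, closure_Ioo zero_ne_one]; rfl

theorem isCompact_closedSquare : IsCompact closedSquare := isCompact_Icc.prod isCompact_Icc

theorem exists_mem_openSquare_of_continuousOn {ρ : ℝ × ℝ → S} (hρ : ContinuousOn ρ closedSquare)
    {q : ℝ × ℝ} (hq : q ∈ closedSquare) {B : Set (ℝ × ℝ)} (hB : B ∈ 𝓝 q) {W : Set S}
    (hW : W ∈ 𝓝 (ρ q)) : ∃ q' ∈ openSquare ∩ B, ρ q' ∈ W := by
  have h1 : ∀ᶠ q' in 𝓝[openSquare] q, ρ q' ∈ W :=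
    ((hρ q hq).mono openSquare_subset_closedSquare) hW
  have : (𝓝[openSquare] q).NeBot := mem_closure_iff_nhdsWithin_neBot.1 (by
    rwa [closure_openSquare])
  obtain ⟨q', h2, h3, h4⟩ :=
    (h1.and (eventually_mem_nhdsWithin.and (nhdsWithin_le_nhds hB))).exists
  exact ⟨q', ⟨h3, h4⟩, h2⟩

/-- The boundary of the square is not mapped into the interior of the rectangle. -/
theorem IsSquareParam.mem_openSquare (hP : IsSquareParam P) {p : ℝ × ℝ} (hp : p ∈ closedSquare)
    (h : P p ∈ P '' openSquare) : p ∈ openSquare := by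
  obtain ⟨a, ha, he⟩ := h
  by_contra hpo
  have hne : a ≠ p := fun h => hpo (h ▸ ha)
  obtain ⟨A, B, hA, hB, haA, hpB, hAB⟩ := t2_separation hne
  have hW : P '' (A ∩ openSquare) ∈ 𝓝 (P p) :=
    (hP.isOpen_image (hA.inter isOpen_openSquare) inter_subset_right).mem_nhds
      ⟨a, ⟨haA, ha⟩, he⟩
  obtain ⟨q, ⟨hq, hqB⟩, b, ⟨hbA, hb⟩, hbq⟩ :=
    exists_mem_openSquare_of_continuousOn hP.continuousOn hp (hB.mem_nhds hpB) hW
  rw [hP.injOn hb hq hbq] at hbA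
  exact disjoint_left.1 hAB hbA hqB

theorem swap_mem_openSquare {p : ℝ × ℝ} : p.swap ∈ openSquare ↔ p ∈ openSquare := and_comm

theorem swap_mem_closedSquare {p : ℝ × ℝ} : p.swap ∈ closedSquare ↔ p ∈ closedSquare := and_comm

theorem image_comp_swap_openSquare {X : Type*} (P : ℝ × ℝ → X) :
    (P ∘ Prod.swap) '' openSquare = P '' openSquare := by
  rw [image_comp, openSquare, image_swap_prod]

theorem IsSquareParam.swap (hP : IsSquareParam P) : IsSquareParam (P ∘ Prod.swap) where
  continuousOn := hP.continuousOn.comp continuous_swap.continuousOn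
    fun _ hp => swap_mem_closedSquare.2 hp
  isOpenEmbedding := by
    let e : openSquare ≃ₜ openSquare :=
      (Homeomorph.prodComm ℝ ℝ).subtype fun p => swap_mem_openSquare.symm
    exact hP.isOpenEmbedding.comp e.isOpenEmbedding

/-- The trace of `H` on the open square is a union of horizontal segments. -/
def HSaturated (P : ℝ × ℝ → S) (H : Set S) : Prop :=
  ∀ p ∈ openSquare, P p ∈ H → ∀ s ∈ Ioo (0 : ℝ) 1, P (s, p.2) ∈ H

theorem hSaturated_of_segments [T2Space S] (hP : IsSquareParam P) {ρ : ℝ × ℝ → S} {H : Set S}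
    (hρ : ContinuousOn ρ closedSquare) (him : ρ '' closedSquare = H)
    (hseg : ∀ t ∈ Ioo (0 : ℝ) 1, ∃ t' ∈ Icc (0 : ℝ) 1, ρ '' hSegment t = P '' hSegment t') :
    HSaturated P H := by
  intro p hp hpH s hs
  have hH : IsClosed H := him ▸ (isCompact_closedSquare.image_of_continuousOn hρ).isClosed
  rw [← hH.closure_eq, mem_closure_iff_nhds]
  intro W hW
  obtain ⟨q, hq, hqp⟩ : P p ∈ ρ '' closedSquare := by rwa [him]
  have hsp : (s, p.2) ∈ openSquare := ⟨hs, hp.2⟩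
  have hc : ContinuousAt (fun t : ℝ => P (s, t)) p.2 :=
    ContinuousAt.comp (f := fun t : ℝ => (s, t)) ((hP.continuousOn.mono
      openSquare_subset_closedSquare).continuousAt (isOpen_openSquare.mem_nhds hsp)) (by fun_prop)
  obtain ⟨T, hT, hTo, hpT⟩ := mem_nhds_iff.1 (hc.preimage_mem_nhds hW)
  have hB : IsOpen (openSquare ∩ Prod.snd ⁻¹' T) :=
    isOpen_openSquare.inter (hTo.preimage continuous_snd)
  have hPB : P '' (openSquare ∩ Prod.snd ⁻¹' T) ∈ 𝓝 (ρ q) :=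
    (hP.isOpen_image hB inter_subset_left).mem_nhds ⟨p, ⟨hp, hpT⟩, hqp.symm⟩
  obtain ⟨q', ⟨hq', -⟩, b, ⟨hb, hbT⟩, hbq⟩ :=
    exists_mem_openSquare_of_continuousOn hρ hq univ_mem hPB
  obtain ⟨t', ht', he⟩ := hseg q'.2 hq'.2
  have hq'c := openSquare_subset_closedSquare hq'
  obtain ⟨a, ha, haq⟩ : ρ q' ∈ P '' hSegment t' := he ▸ ⟨q', ⟨hq'c.1, rfl⟩, rfl⟩
  have ha2 : a.2 = t' := ha.2
  have hao : a ∈ openSquare := by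
    refine hP.mem_openSquare ⟨ha.1, by rwa [ha2]⟩ ?_
    rw [haq, ← hbq]
    exact mem_image_of_mem P hb
  have hab : a = b := hP.injOn hao hb (haq.trans hbq.symm)
  have hbt : t' = b.2 := by rw [← hab]; exact ha2.symm
  refine ⟨P (s, t'), hT (by rw [hbt]; exact hbT), ?_⟩
  have h1 : P (s, t') ∈ ρ '' hSegment q'.2 := he ▸ ⟨(s, t'), ⟨Ioo_subset_Icc_self hs, rfl⟩, rfl⟩
  rw [← him]
  refine image_mono ?_ h1
  rintro r ⟨hr1, hr2⟩
  have hr2 : r.2 = q'.2 := hr2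
  exact ⟨hr1, by rw [hr2]; exact hq'c.2⟩

/-- `C` is the interior of a horizontal band of the square `P`. -/
structure IsBand (P : ℝ × ℝ → S) (C : Set S) : Prop where
  isOpen : IsOpen C
  isConnected : IsConnected C
  subset : C ⊆ P '' openSquare
  saturated : HSaturated P (closure C)

/-- The projection of `C` to the vertical side of the square. -/
def sideProj (P : ℝ × ℝ → S) (C : Set S) : Set ℝ := Prod.snd '' (openSquare ∩ P ⁻¹' C)

theorem sideProj_subset {X : Type*} {P : ℝ × ℝ → X} (C : Set X) :
    sideProj P C ⊆ Ioo 0 1 := by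
  rintro _ ⟨p, hp, rfl⟩; exact hp.1.2

theorem IsBand.nonempty_sideProj {C : Set S} (hC : IsBand P C) : (sideProj P C).Nonempty := by
  obtain ⟨_, hx⟩ := hC.isConnected.nonempty
  obtain ⟨p, hp, rfl⟩ := hC.subset hx
  exact ⟨_, p, ⟨hp, hx⟩, rfl⟩

theorem IsBand.ordConnected_sideProj (hP : IsSquareParam P) {C : Set S} (hC : IsBand P C) :
    (sideProj P C).OrdConnected := by
  have h1 : IsPreconnected (openSquare.domRestrict P ⁻¹' C) := by
    refine hC.isConnected.isPreconnected.preimage_of_isOpenMap hP.isOpenEmbedding.injective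
      hP.isOpenEmbedding.isOpenMap ?_
    rw [range_domRestrict]
    exact hC.subset
  have h2 : sideProj P C = (fun a : openSquare => (a : ℝ × ℝ).2) ''
      (openSquare.domRestrict P ⁻¹' C) := by
    ext t
    constructor
    · rintro ⟨p, ⟨hp, hpC⟩, rfl⟩; exact ⟨⟨p, hp⟩, hpC, rfl⟩
    · rintro ⟨p, hp, rfl⟩; exact ⟨p, ⟨p.2, hp⟩, rfl⟩
  rw [h2]
  exact (h1.image _ (by fun_prop)).ordConnected

theorem IsBand.mem_closure {C : Set S} (hC : IsBand P C) {t : ℝ} (ht : t ∈ sideProj P C) {s : ℝ}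
    (hs : s ∈ Ioo (0 : ℝ) 1) : P (s, t) ∈ closure C := by
  obtain ⟨p, ⟨hp, hpC⟩, rfl⟩ := ht
  exact hC.saturated p hp (subset_closure hpC) s hs

theorem IsBand.disjoint_sideProj {C C' : Set S} (hC : IsBand P C) (hC' : IsBand P C')
    (h : Disjoint C C') : Disjoint (sideProj P C) (sideProj P C') := by
  refine disjoint_left.2 ?_
  rintro _ ⟨p, ⟨hp, hpC⟩, rfl⟩ ht'
  have h1 := hC'.mem_closure ht' hp.1
  obtain ⟨x, hx, hx'⟩ := mem_closure_iff.1 h1 C hC.isOpen hpC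
  exact disjoint_left.1 h hx hx'

theorem mem_closure_sideProj (hP : IsSquareParam P) {C : Set S} {p : ℝ × ℝ} (hp : p ∈ openSquare)
    (h : P p ∈ closure C) : p.2 ∈ closure (sideProj P C) := by
  refine mem_closure_iff.2 fun T hT hpT => ?_
  have hB : IsOpen (openSquare ∩ Prod.snd ⁻¹' T) :=
    isOpen_openSquare.inter (hT.preimage continuous_snd)
  obtain ⟨_, ⟨b, ⟨hb, hbT⟩, rfl⟩, hbC⟩ := mem_closure_iff.1 h _
    (hP.isOpen_image hB inter_subset_left) ⟨p, ⟨hp, hpT⟩, rfl⟩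
  exact ⟨b.2, hbT, b, ⟨hb, hbC⟩, rfl⟩

/-- Disjoint bands are ordered along the side of the square. -/
theorem exists_order_of_isBand (hP : IsSquareParam P) {𝓗 : Set (Set S)} {C : Set S → Set S}
    (hC : ∀ H ∈ 𝓗, IsBand P (C H) ∧ closure (C H) = H) (hd : 𝓗.PairwiseDisjoint C) :
    ∃ κ : Set S → ℝ, InjOn κ 𝓗 ∧ (∀ H ∈ 𝓗, ∃ p ∈ openSquare, P p ∈ H ∧ p.2 = κ H) ∧
      ∀ H ∈ 𝓗, ∀ H' ∈ 𝓗, κ H < κ H' → ∀ p ∈ openSquare, ∀ p' ∈ openSquare,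
        P p ∈ H → P p' ∈ H' → p.2 ≤ p'.2 := by
  have hex : ∀ H, ∃ t, H ∈ 𝓗 → t ∈ sideProj P (C H) := fun H => by
    by_cases hH : H ∈ 𝓗
    · obtain ⟨t, ht⟩ := (hC H hH).1.nonempty_sideProj
      exact ⟨t, fun _ => ht⟩
    · exact ⟨0, fun h => absurd h hH⟩
  choose κ hκ using hex
  have hdisj : ∀ H ∈ 𝓗, ∀ H' ∈ 𝓗, H ≠ H' → Disjoint (sideProj P (C H)) (sideProj P (C H')) :=
    fun H hH H' hH' hne => (hC H hH).1.disjoint_sideProj (hC H' hH').1 (hd hH hH' hne)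
  refine ⟨κ, fun H hH H' hH' he => ?_, fun H hH => ?_, ?_⟩
  · by_contra hne
    exact disjoint_left.1 (hdisj H hH H' hH' hne) (hκ H hH) (he ▸ hκ H' hH')
  · obtain ⟨p, ⟨hp, hpC⟩, he⟩ := hκ H hH
    refine ⟨p, hp, ?_, he⟩
    rw [← (hC H hH).2]
    exact subset_closure hpC
  · intro H hH H' hH' hlt p hp p' hp' hpH hpH'
    have hd' := hdisj H hH H' hH' (by rintro rfl; exact lt_irrefl _ hlt)
    have ho := (hC H hH).1.ordConnected_sideProj hP
    have ho' := (hC H' hH').1.ordConnected_sideProj hP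
    have hle : ∀ t ∈ sideProj P (C H), ∀ t' ∈ sideProj P (C H'), t ≤ t' := by
      intro t ht t' ht'
      by_contra! hcon
      rcases le_or_gt t (κ H') with h1 | h1
      · exact disjoint_left.1 hd' ht (ho'.out ht' (hκ H' hH') ⟨hcon.le, h1⟩)
      · exact disjoint_left.1 hd' (ho.out (hκ H hH) ht ⟨hlt.le, h1.le⟩) (hκ H' hH')
    rw [← (hC H hH).2] at hpH
    rw [← (hC H' hH').2] at hpH'
    have h1 : ∀ t' ∈ sideProj P (C H'), p.2 ≤ t' := fun t' ht' =>
      closure_minimal (fun t ht => hle t ht t' ht') isClosed_Iic (mem_closure_sideProj hP hp hpH)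
    exact closure_minimal h1 isClosed_Ici (mem_closure_sideProj hP hp' hpH')

/-- If `f` maps infinitely many disjoint bands of `P` to bands of `Q`, then it maps some segment of
`P`, a limit of these bands, into a segment of `Q`. -/
theorem exists_segment_of_infinite_bands [T2Space S] (hP : IsSquareParam P) (hQ : IsSquareParam Q)
    (f : S ≃ₜ S) {ι : Type*} [Infinite ι] {C : ι → Set S} (hC : ∀ i, IsBand P (C i))
    (hfC : ∀ i, IsBand Q (f '' C i)) (hd : Pairwise fun i j => Disjoint (C i) (C j)) :
    ∃ t ∈ Icc (0 : ℝ) 1, ∃ s ∈ Icc (0 : ℝ) 1, ∀ r ∈ Ioo (0 : ℝ) 1,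
      f (P (r, t)) ∈ Q '' hSegment s := by
  let 𝒰 : Ultrafilter ι := hyperfilter ι
  have hlim : ∀ a : ι → ℝ, (∀ i, a i ∈ Icc (0 : ℝ) 1) →
      ∃ l ∈ Icc (0 : ℝ) 1, Tendsto a 𝒰 (𝓝 l) := fun a ha =>
    isCompact_Icc.ultrafilter_le_nhds (𝒰.map a) (le_principal_iff.2
      (Eventually.of_forall ha : ∀ᶠ i in (𝒰 : Filter ι), a i ∈ Icc (0 : ℝ) 1))
  choose t ht using fun i => (hC i).nonempty_sideProj
  choose b hb using fun i => (hfC i).nonempty_sideProj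
  have hsub : ∀ i, sideProj Q (f '' C i) ⊆ Icc 0 1 := fun i =>
    (sideProj_subset _).trans Ioo_subset_Icc_self
  obtain ⟨t₀, ht₀, htlim⟩ := hlim t fun i => Ioo_subset_Icc_self (sideProj_subset _ (ht i))
  obtain ⟨s₀, hs₀, hslim⟩ := hlim b fun i => hsub i (hb i)
  -- The projections are disjoint intervals, so no point lies in many of them: they shrink to `s₀`.
  have hshrink : ∀ m : ℝ, ¬ ∀ᶠ i in (𝒰 : Filter ι), m ∈ sideProj Q (f '' C i) := by
    intro m hm
    have hinf : {i | m ∈ sideProj Q (f '' C i)}.Infinite := fun hfin =>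
      notMem_hyperfilter_of_finite hfin hm
    obtain ⟨i, hi, j, hj, hij⟩ := hinf.nontrivial
    have hdij : Disjoint (f '' C i) (f '' C j) :=
      (disjoint_image_iff f.injective).2 (hd hij)
    exact disjoint_left.1 ((hfC i).disjoint_sideProj (hfC j) hdij) hi hj
  refine ⟨t₀, ht₀, s₀, hs₀, fun r hr => ?_⟩
  have hmem : ∀ i, ∃ q ∈ Icc (0 : ℝ) 1 ×ˢ closure (sideProj Q (f '' C i)),
      Q q = f (P (r, t i)) := by
    intro i
    have hcl : closure (sideProj Q (f '' C i)) ⊆ Icc 0 1 := closure_minimal (hsub i) isClosed_Icc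
    have hcomp : IsCompact (Q '' (Icc (0 : ℝ) 1 ×ˢ closure (sideProj Q (f '' C i)))) :=
      (isCompact_Icc.prod (isCompact_Icc.of_isClosed_subset isClosed_closure hcl))
        |>.image_of_continuousOn (hQ.continuousOn.mono (prod_mono subset_rfl hcl))
    have h1 : f (P (r, t i)) ∈ closure (f '' C i) := by
      rw [← f.image_closure]
      exact mem_image_of_mem f ((hC i).mem_closure (ht i) hr)
    refine closure_minimal ?_ hcomp.isClosed h1
    intro x hx
    obtain ⟨p, hp, rfl⟩ := (hfC i).subset hx
    exact ⟨p, ⟨Ioo_subset_Icc_self hp.1, subset_closure ⟨p, ⟨hp, hx⟩, rfl⟩⟩, rfl⟩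
  choose q hq hqe using hmem
  have hq2 : ∀ i, (q i).2 ∈ Icc (0 : ℝ) 1 := fun i =>
    closure_minimal (hsub i) isClosed_Icc (hq i).2
  obtain ⟨a₀, ha₀, halim⟩ := hlim (fun i => (q i).1) fun i => (hq i).1
  obtain ⟨x₀, hx₀, hxlim⟩ := hlim (fun i => (q i).2) hq2
  have hxs : x₀ = s₀ := by
    rcases lt_trichotomy x₀ s₀ with hlt | heq | hlt
    · exfalso
      obtain ⟨m, hm1, hm2⟩ := exists_between hlt
      refine hshrink m ?_
      filter_upwards [hxlim.eventually (gt_mem_nhds hm1), hslim.eventually (lt_mem_nhds hm2)]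
        with i h1 h2
      obtain ⟨y, hy1, hy2⟩ := mem_closure_iff.1 (hq i).2 _ isOpen_Iio h1
      exact ((hfC i).ordConnected_sideProj hQ).out hy2 (hb i) ⟨le_of_lt hy1, h2.le⟩
    · exact heq
    · exfalso
      obtain ⟨m, hm1, hm2⟩ := exists_between hlt
      refine hshrink m ?_
      filter_upwards [hxlim.eventually (lt_mem_nhds hm2), hslim.eventually (gt_mem_nhds hm1)]
        with i h1 h2
      obtain ⟨y, hy1, hy2⟩ := mem_closure_iff.1 (hq i).2 _ isOpen_Ioi h1
      exact ((hfC i).ordConnected_sideProj hQ).out (hb i) hy2 ⟨h2.le, le_of_lt hy1⟩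
  have hlim1 : Tendsto (fun i => f (P (r, t i))) 𝒰 (𝓝 (f (P (r, t₀)))) := by
    refine (f.continuous.tendsto _).comp ?_
    refine (hP.continuousOn (r, t₀) ⟨Ioo_subset_Icc_self hr, ht₀⟩).tendsto.comp ?_
    refine tendsto_nhdsWithin_iff.2 ⟨tendsto_const_nhds.prodMk_nhds htlim,
      Eventually.of_forall fun i => ⟨Ioo_subset_Icc_self hr,
        Ioo_subset_Icc_self (sideProj_subset _ (ht i))⟩⟩
  have hlim2 : Tendsto (fun i => Q (q i)) 𝒰 (𝓝 (Q (a₀, x₀))) := by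
    refine (hQ.continuousOn (a₀, x₀) ⟨ha₀, hx₀⟩).tendsto.comp ?_
    exact tendsto_nhdsWithin_iff.2 ⟨halim.prodMk_nhds hxlim,
      Eventually.of_forall fun i => ⟨(hq i).1, hq2 i⟩⟩
  have he : f (P (r, t₀)) = Q (a₀, x₀) := by
    refine tendsto_nhds_unique hlim1 ?_
    simpa only [hqe] using hlim2
  exact ⟨(a₀, x₀), ⟨ha₀, hxs⟩, he.symm⟩

end Bands

/-! ### Sorting a finite family of sets -/

/-- `κ` sorts the family `𝓗` with respect to the relation `B`. -/
structure Sorts {X : Type*} (B : Set X → Set X → Prop) (𝓗 : Set (Set X)) (κ : Set X → ℝ) :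
    Prop where
  injOn : InjOn κ 𝓗
  rel_of_lt : ∀ H ∈ 𝓗, ∀ H' ∈ 𝓗, κ H < κ H' → B H H'
  le_of_rel : ∀ H ∈ 𝓗, ∀ H' ∈ 𝓗, B H H' → κ H ≤ κ H'

section Sorting

variable {X : Type*} {B : Set X → Set X → Prop} {𝓗 : Set (Set X)} {κ : Set X → ℝ}

theorem Sorts.exists_enumeration (h : Sorts B 𝓗 κ) (hfin : 𝓗.Finite) :
    ∃ E : Fin 𝓗.ncard → Set X, BijOn E univ 𝓗 ∧ ∀ j j', j < j' → B (E j) (E j') := by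
  classical
  have hcard : (hfin.toFinset.image κ).card = 𝓗.ncard := by
    rw [Finset.card_image_of_injOn (by simpa using h.injOn), ncard_eq_toFinset_card 𝓗 hfin]
  set o := (hfin.toFinset.image κ).orderEmbOfFin hcard with ho
  have hmem : ∀ j, ∃ H ∈ 𝓗, κ H = o j := fun j => by
    have := (hfin.toFinset.image κ).orderEmbOfFin_mem hcard j
    obtain ⟨H, hH, he⟩ := Finset.mem_image.1 this
    exact ⟨H, hfin.mem_toFinset.1 hH, he⟩
  choose E hE hκ using hmem
  refine ⟨E, ⟨fun j _ => hE j, fun j _ j' _ he => ?_, fun H hH => ?_⟩, fun j j' hjj => ?_⟩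
  · exact o.injective (by rw [← hκ, ← hκ, he])
  · have h1 : κ H ∈ range o := by
      rw [ho, Finset.range_orderEmbOfFin]
      simpa using ⟨H, hH, rfl⟩
    obtain ⟨j, hj⟩ := h1
    exact ⟨j, mem_univ j, h.injOn (hE j) hH ((hκ j).trans hj)⟩
  · exact h.rel_of_lt _ (hE j) _ (hE j') (by rw [hκ, hκ]; exact o.strictMono hjj)

theorem Sorts.enumeration_unique (h : Sorts B 𝓗 κ) {m : ℕ} {E E' : Fin m → Set X}
    (hE : BijOn E univ 𝓗) (hB : ∀ j j', j < j' → B (E j) (E j'))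
    (hE' : BijOn E' univ 𝓗) (hB' : ∀ j j', j < j' → B (E' j) (E' j')) : E = E' := by
  have hmono : ∀ {E : Fin m → Set X}, BijOn E univ 𝓗 → (∀ j j', j < j' → B (E j) (E j')) →
      StrictMono (κ ∘ E) ∧ range (κ ∘ E) = κ '' 𝓗 := by
    intro E hE hB
    refine ⟨fun j j' hjj => ?_, ?_⟩
    · have h1 := hE.mapsTo (mem_univ j)
      have h2 := hE.mapsTo (mem_univ j')
      refine (h.le_of_rel _ h1 _ h2 (hB j j' hjj)).lt_of_ne fun he => hjj.ne ?_
      exact hE.injOn (mem_univ j) (mem_univ j') (h.injOn h1 h2 he)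
    · rw [range_comp, ← image_univ, hE.image_eq]
  obtain ⟨h1, h2⟩ := hmono hE hB
  obtain ⟨h3, h4⟩ := hmono hE' hB'
  have h5 := (StrictMono.range_inj h1 h3).1 (h2.trans h4.symm)
  funext j
  exact h.injOn (hE.mapsTo (mem_univ j)) (hE'.mapsTo (mem_univ j)) (congrFun h5 j)

end Sorting

/-! ### Transport along a conjugacy -/

theorem componentClosures_image {X Y : Type*} [TopologicalSpace X] [TopologicalSpace Y]
    (h : X ≃ₜ Y) (W : Set X) :
    componentClosures (h '' W) = image h '' componentClosures W := by
  ext K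
  constructor
  · rintro ⟨_, ⟨x, hx, rfl⟩, rfl⟩
    exact ⟨_, ⟨x, hx, rfl⟩, by rw [h.image_closure, h.image_connectedComponentIn hx]⟩
  · rintro ⟨_, ⟨x, hx, rfl⟩, rfl⟩
    exact ⟨h x, mem_image_of_mem h hx, by
      rw [h.image_closure, h.image_connectedComponentIn hx]⟩

theorem componentClosures_image_inter {X : Type*} [TopologicalSpace X] (f : X ≃ₜ X) (A B : Set X) :
    componentClosures (f '' A ∩ B) = image f '' componentClosures (A ∩ f ⁻¹' B) := by
  rw [← componentClosures_image, image_inter_preimage]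

namespace GeometricRectangle

theorem inner_map {S S' : Type*} (h : S → S') (R : GeometricRectangle S) :
    (R.map h).inner = h '' R.inner := by
  rw [inner, inner, image_image]; rfl

theorem carrier_map {S S' : Type*} (h : S → S') (R : GeometricRectangle S) :
    (R.map h).carrier = h '' R.carrier := by
  rw [carrier, carrier, image_image]; rfl

end GeometricRectangle

section Transport

variable {S S' : Type*} [TopologicalSpace S] [TopologicalSpace S'] {f : S ≃ₜ S} {g : S' ≃ₜ S'}
  {h : S ≃ₜ S'} {n : ℕ} {R : Fin n → GeometricRectangle S}

theorem horizontalSubrectangles_map (hconj : ∀ x, g (h x) = h (f x)) (i : Fin n) :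
    horizontalSubrectangles g (fun i => (R i).map h) i =
      image h '' horizontalSubrectangles f R i := by
  rw [horizontalSubrectangles, horizontalSubrectangles, image_iUnion]
  refine iUnion_congr fun k => ?_
  rw [← componentClosures_image, GeometricRectangle.inner_map, GeometricRectangle.inner_map]
  congr 1
  rw [image_inter h.injective]
  congr 1
  ext y
  obtain ⟨x, rfl⟩ := h.surjective y
  rw [h.injective.mem_set_image, mem_preimage, hconj, h.injective.mem_set_image]
  rfl

theorem verticalSubrectangles_map (hconj : ∀ x, g (h x) = h (f x)) (k : Fin n) :
    verticalSubrectangles g (fun i => (R i).map h) k =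
      image h '' verticalSubrectangles f R k := by
  rw [verticalSubrectangles, verticalSubrectangles, image_iUnion]
  refine iUnion_congr fun i => ?_
  rw [← componentClosures_image, GeometricRectangle.inner_map, GeometricRectangle.inner_map,
    image_inter h.injective, image_image, image_image]
  simp only [hconj]

theorem verticalDirectionsCoincide_map (hconj : ∀ x, g (h x) = h (f x))
    (A B : GeometricRectangle S) (H : Set S) :
    VerticalDirectionsCoincide g (A.map h) (B.map h) (h '' H) ↔
      VerticalDirectionsCoincide f A B H := by
  simp only [VerticalDirectionsCoincide, GeometricRectangle.inner_map]
  simp only [GeometricRectangle.map, hconj, h.injective.mem_set_image, h.injective.eq_iff]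
  rfl

theorem IsGeometricType.map (hconj : ∀ x, g (h x) = h (f x)) {T : GeometricType}
    (hT : IsGeometricType f R T) : IsGeometricType g (fun i => (R i).map h) T := by
  obtain ⟨e, H, V, hH, hV, hperm, hsign⟩ := hT
  have hinj : Function.Injective (image h) := h.injective.image_injective
  refine ⟨e, fun i j => h '' H i j, fun k l => h '' V k l, fun i => ⟨?_, ?_⟩,
    fun k => ⟨?_, ?_⟩, fun a b => ?_, fun a => ?_⟩
  · rw [horizontalSubrectangles_map hconj]
    exact hinj.injOn.bijOn_image.comp (hH i).1
  · intro j j' hjj p hp p' hp' h1 h2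
    exact (hH i).2 j j' hjj p hp p' hp' (h.injective.mem_set_image.1 h1)
      (h.injective.mem_set_image.1 h2)
  · rw [verticalSubrectangles_map hconj]
    exact hinj.injOn.bijOn_image.comp (hV k).1
  · intro l l' hll p hp p' hp' h1 h2
    exact (hV k).2 l l' hll p hp p' hp' (h.injective.mem_set_image.1 h1)
      (h.injective.mem_set_image.1 h2)
  · rw [hperm, image_image, ← hinj.eq_iff, image_image]
    simp only [hconj]
  · rw [hsign]
    exact (verticalDirectionsCoincide_map hconj _ _ _).symm

theorem isGeometricType_map_iff (hconj : ∀ x, g (h x) = h (f x)) (T : GeometricType) :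
    IsGeometricType g (fun i => (R i).map h) T ↔ IsGeometricType f R T := by
  refine ⟨fun hT => ?_, IsGeometricType.map hconj⟩
  have h1 := IsGeometricType.map (h := h.symm) (g := f) (fun x => by
    obtain ⟨y, rfl⟩ := h.surjective x
    rw [hconj, h.symm_apply_apply, h.symm_apply_apply]) hT
  simpa [GeometricRectangle.map] using h1

end Transport

section TransportPartition

variable {S S' : Type*} [TopologicalSpace S] [OrientedSurface S]
  [TopologicalSpace S'] [OrientedSurface S'] {Fs Fu : MeasuredFoliation S}
  {Gs Gu : MeasuredFoliation S'} {f : S ≃ₜ S} {g : S' ≃ₜ S'} {h : S ≃ₜ S'}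

theorem IsGeometricMarkovPartition.map {n : ℕ} {R : Fin n → GeometricRectangle S}
    (hR : IsGeometricMarkovPartition f Fs Fu R) (hh : OrientationPreserving h)
    (hconj : ∀ x, g (h x) = h (f x)) (hs : ∀ x, h '' Fs.leaf x ⊆ Gs.leaf (h x))
    (hu : ∀ x, h '' Fu.leaf x ⊆ Gu.leaf (h x)) :
    IsGeometricMarkovPartition g Gs Gu (fun i => (R i).map h) where
  rectangle i := by
    rw [GeometricRectangle.carrier_map]
    exact (hR.rectangle i).comp_homeomorph hh hs hu
  cover := by
    simp only [GeometricRectangle.carrier_map]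
    rw [← image_iUnion, hR.cover, image_univ, h.surjective.range_eq]
  disjoint i j hij := by
    rw [GeometricRectangle.inner_map, GeometricRectangle.inner_map, ← image_inter h.injective,
      hR.disjoint i j hij, image_empty]
  horizontal i H hH := by
    rw [horizontalSubrectangles_map hconj] at hH
    obtain ⟨H, hH, rfl⟩ := hH
    obtain ⟨hsub, ρ, hρ, hseg⟩ := hR.horizontal i H hH
    refine ⟨?_, _, hρ.comp_homeomorph hh hs hu, fun t ht => ?_⟩
    · rw [GeometricRectangle.carrier_map]; exact image_mono hsub
    · obtain ⟨t', ht', he⟩ := hseg t ht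
      refine ⟨t', ht', ?_⟩
      rw [← image_image h ρ, he, image_image]; rfl
  vertical k V hV := by
    rw [verticalSubrectangles_map hconj] at hV
    obtain ⟨V, hV, rfl⟩ := hV
    obtain ⟨hsub, ρ, hρ, hseg⟩ := hR.vertical k V hV
    refine ⟨?_, _, hρ.comp_homeomorph hh hs hu, fun t ht => ?_⟩
    · rw [GeometricRectangle.carrier_map]; exact image_mono hsub
    · obtain ⟨t', ht', he⟩ := hseg t ht
      refine ⟨t', ht', ?_⟩
      rw [← image_image h ρ, he, image_image]; rfl

end TransportPartition

/-! ### The subrectangles of a Markov partition -/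

theorem disjoint_connectedComponentIn_of_ne {X : Type*} [TopologicalSpace X] {W : Set X}
    {x y : X}
    (h : connectedComponentIn W x ≠ connectedComponentIn W y) :
    Disjoint (connectedComponentIn W x) (connectedComponentIn W y) := by
  refine disjoint_left.2 fun z hz hz' => h ?_
  rw [connectedComponentIn_eq hz, connectedComponentIn_eq hz']

section Components

variable {S : Type*} [TopologicalSpace S] [LocallyConnectedSpace S]

/-- Open sets whose components have a closure in common meet. -/
theorem inter_nonempty_of_mem_componentClosures {W W' H : Set S} (hW : IsOpen W)
    (h : H ∈ componentClosures W) (h' : H ∈ componentClosures W') : (W ∩ W').Nonempty := by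
  obtain ⟨x, hx, rfl⟩ := h
  obtain ⟨x', -, he⟩ := h'
  have h1 : x ∈ closure (connectedComponentIn W' x') :=
    he ▸ subset_closure (mem_connectedComponentIn hx)
  obtain ⟨y, hy, hy'⟩ := mem_closure_iff.1 h1 _ hW.connectedComponentIn
    (mem_connectedComponentIn hx)
  exact ⟨y, connectedComponentIn_subset _ _ hy, connectedComponentIn_subset _ _ hy'⟩

theorem isBand_connectedComponentIn {P : ℝ × ℝ → S} {W : Set S} (hW : IsOpen W)
    (hWP : W ⊆ P '' openSquare) {x : S} (hx : x ∈ W)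
    (hsat : HSaturated P (closure (connectedComponentIn W x))) :
    IsBand P (connectedComponentIn W x) :=
  ⟨hW.connectedComponentIn, isConnected_connectedComponentIn_iff.2 hx,
    (connectedComponentIn_subset _ _).trans hWP, hsat⟩

/-- The closures of the components of a disjoint family of open sets are sorted by the vertical
coordinate, if they are saturated by horizontal segments. -/
theorem exists_sorts_of_hSaturated {P : ℝ × ℝ → S} (hP : IsSquareParam P) {ι : Type*}
    {W : ι → Set S} (hW : ∀ k, IsOpen (W k)) (hWP : ∀ k, W k ⊆ P '' openSquare)
    (hd : ∀ k l, k ≠ l → Disjoint (W k) (W l))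
    (hsat : ∀ H ∈ ⋃ k, componentClosures (W k), HSaturated P H) (ε : ℤˣ) :
    ∃ κ, Sorts (fun H H' => ∀ p ∈ openSquare, ∀ p' ∈ openSquare, P p ∈ H → P p' ∈ H' →
      ((ε : ℤ) : ℝ) * p.2 ≤ ((ε : ℤ) : ℝ) * p'.2) (⋃ k, componentClosures (W k)) κ := by
  set 𝓗 := ⋃ k, componentClosures (W k)
  have hex : ∀ H, ∃ C, H ∈ 𝓗 → ∃ k, ∃ x ∈ W k, C = connectedComponentIn (W k) x ∧
      H = closure C := fun H => by
    by_cases hH : H ∈ 𝓗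
    · obtain ⟨k, x, hx, he⟩ := mem_iUnion.1 hH
      exact ⟨_, fun _ => ⟨k, x, hx, rfl, he⟩⟩
    · exact ⟨∅, fun h => absurd h hH⟩
  choose C hC using hex
  have hband : ∀ H ∈ 𝓗, IsBand P (C H) ∧ closure (C H) = H := by
    intro H hH
    obtain ⟨k, x, hx, he, hHC⟩ := hC H hH
    refine ⟨?_, hHC.symm⟩
    have := hsat H hH
    rw [he] at hHC ⊢
    rw [hHC] at this
    exact isBand_connectedComponentIn (hW k) (hWP k) hx this
  have hdisj : 𝓗.PairwiseDisjoint C := by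
    intro H hH H' hH' hne
    obtain ⟨k, x, hx, he, hHC⟩ := hC H hH
    obtain ⟨k', x', hx', he', hHC'⟩ := hC H' hH'
    change Disjoint (C H) (C H')
    rcases eq_or_ne k k' with rfl | hk
    · have hCC : C H ≠ C H' := fun h => hne (by rw [hHC, hHC', h])
      rw [he, he'] at hCC ⊢
      exact disjoint_connectedComponentIn_of_ne hCC
    · rw [he, he']
      exact (hd k k' hk).mono (connectedComponentIn_subset _ _) (connectedComponentIn_subset _ _)
  obtain ⟨κ, hinj, hpt, hlt⟩ := exists_order_of_isBand hP hband hdisj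
  refine ⟨fun H => ((ε : ℤ) : ℝ) * κ H, ?_, ?_, ?_⟩
  · intro H hH H' hH' he
    refine hinj hH hH' ?_
    rcases Int.units_eq_one_or ε with rfl | rfl <;> simpa using he
  · intro H hH H' hH' h p hp p' hp' h1 h2
    rcases Int.units_eq_one_or ε with rfl | rfl
    · simp only [Units.val_one, Int.cast_one, one_mul] at h ⊢
      exact hlt H hH H' hH' h p hp p' hp' h1 h2
    · simp only [Units.val_neg, Units.val_one, Int.cast_neg, Int.cast_one, neg_mul, one_mul,
        neg_lt_neg_iff, neg_le_neg_iff] at h ⊢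
      exact hlt H' hH' H hH h p' hp' p hp h2 h1
  · intro H hH H' hH' h
    obtain ⟨p, hp, hpH, he⟩ := hpt H hH
    obtain ⟨p', hp', hpH', he'⟩ := hpt H' hH'
    have := h p hp p' hp' hpH hpH'
    rwa [he, he'] at this

end Components

section Partition

variable {S : Type*} [TopologicalSpace S] [OrientedSurface S] {f : S ≃ₜ S}
  {Fs Fu : MeasuredFoliation S} {n : ℕ} {R : Fin n → GeometricRectangle S}

theorem IsParametrization.isSquareParam {ρ : ℝ × ℝ → S} {A : Set S}
    (h : IsParametrization Fs Fu ρ A) : IsSquareParam ρ :=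
  ⟨h.continuousOn, h.isOpenEmbedding⟩

theorem IsHorizontalSubrectangle.hSaturated [T2Space S] {A : GeometricRectangle S} {H : Set S}
    (hA : IsSquareParam A.param) (h : IsHorizontalSubrectangle Fs Fu A H) :
    HSaturated A.param H := by
  obtain ⟨-, ρ, hρ, hseg⟩ := h
  exact hSaturated_of_segments hA hρ.continuousOn hρ.image_eq hseg

theorem image_comp_swap_hSegment {X : Type*} (P : ℝ × ℝ → X) (s : ℝ) :
    (P ∘ Prod.swap) '' hSegment s = P '' vSegment s := by
  rw [image_comp, hSegment, image_swap_prod]; rfl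

theorem IsVerticalSubrectangle.hSaturated [T2Space S] {A : GeometricRectangle S} {V : Set S}
    (hA : IsSquareParam A.param) (h : IsVerticalSubrectangle Fs Fu A V) :
    HSaturated (A.param ∘ Prod.swap) V := by
  obtain ⟨-, ρ, hρ, hseg⟩ := h
  refine hSaturated_of_segments hA.swap hρ.isSquareParam.swap.continuousOn ?_ fun s hs => ?_
  · rw [← hρ.image_eq, image_comp, closedSquare, image_swap_prod]
  · obtain ⟨s', hs', he⟩ := hseg s hs
    exact ⟨s', hs', by rw [image_comp_swap_hSegment, image_comp_swap_hSegment, he]⟩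

variable (hR : IsGeometricMarkovPartition f Fs Fu R)
include hR

theorem IsGeometricMarkovPartition.isSquareParam (i : Fin n) : IsSquareParam (R i).param :=
  (hR.rectangle i).isSquareParam

theorem IsGeometricMarkovPartition.isOpen_inner (i : Fin n) : IsOpen (R i).inner :=
  (hR.isSquareParam i).isOpen_image isOpen_openSquare subset_rfl

theorem IsGeometricMarkovPartition.isOpen_horizontal (i k : Fin n) :
    IsOpen ((R i).inner ∩ f ⁻¹' (R k).inner) :=
  (hR.isOpen_inner i).inter ((hR.isOpen_inner k).preimage f.continuous)

theorem IsGeometricMarkovPartition.isOpen_vertical (i k : Fin n) :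
    IsOpen (f '' (R i).inner ∩ (R k).inner) :=
  (f.isOpenMap _ (hR.isOpen_inner i)).inter (hR.isOpen_inner k)

theorem IsGeometricMarkovPartition.exists_inner_inter_nonempty {U : Set S} (hU : IsOpen U)
    (hne : U.Nonempty) : ∃ k, (U ∩ (R k).inner).Nonempty := by
  obtain ⟨x, hx⟩ := hne
  obtain ⟨k, hk⟩ := mem_iUnion.1 (hR.cover.symm ▸ mem_univ x : x ∈ ⋃ i, (R i).carrier)
  have h1 : (R k).carrier ⊆ closure (R k).inner := by
    rw [GeometricRectangle.carrier, ← closure_openSquare]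
    exact ContinuousOn.image_closure
      (by rw [closure_openSquare]; exact (hR.rectangle k).continuousOn)
  obtain ⟨y, hy⟩ := mem_closure_iff.1 (h1 hk) U hU hx
  exact ⟨k, y, hy⟩

variable [LocallyConnectedSpace S]

theorem IsGeometricMarkovPartition.exists_sorts_horizontal [T2Space S] (i : Fin n) :
    ∃ κ, Sorts (R i).Below (horizontalSubrectangles f R i) κ :=
  exists_sorts_of_hSaturated (hR.isSquareParam i) (fun k => hR.isOpen_horizontal i k)
    (fun _ => inter_subset_left)
    (fun k l hkl => by
      refine Disjoint.mono inter_subset_right inter_subset_right (Disjoint.preimage f ?_)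
      exact disjoint_iff_inter_eq_empty.2 (hR.disjoint k l hkl))
    (fun H hH => (hR.horizontal i H hH).hSaturated (hR.isSquareParam i)) (R i).dir

theorem IsGeometricMarkovPartition.exists_sorts_vertical [T2Space S] (k : Fin n) :
    ∃ κ, Sorts (R k).LeftOf (verticalSubrectangles f R k) κ := by
  obtain ⟨κ, h⟩ := exists_sorts_of_hSaturated (hR.isSquareParam k).swap
    (W := fun i => f '' (R i).inner ∩ (R k).inner) (fun i => hR.isOpen_vertical i k)
    (fun _ => by rw [image_comp_swap_openSquare]; exact inter_subset_right)
    (fun i j hij => by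
      refine Disjoint.mono inter_subset_left inter_subset_left ?_
      exact (disjoint_image_iff f.injective).2
        (disjoint_iff_inter_eq_empty.2 (hR.disjoint i j hij)))
    (fun V hV => (hR.vertical k V hV).hSaturated (hR.isSquareParam k)) (R k).dir
  refine ⟨κ, h.injOn, fun V hV V' hV' hlt p hp p' hp' => ?_, fun V hV V' hV' hB => ?_⟩
  · exact h.rel_of_lt V hV V' hV' hlt p.swap (swap_mem_openSquare.2 hp) p'.swap
      (swap_mem_openSquare.2 hp')
  · exact h.le_of_rel V hV V' hV' fun p hp p' hp' => hB p.swap (swap_mem_openSquare.2 hp) p'.swap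
      (swap_mem_openSquare.2 hp')

/-- If there were infinitely many components, then `f` would map a horizontal segment, a limit of
horizontal subrectangles, into a vertical one, a limit of vertical subrectangles. But an arc cannot
lie both in a stable and in an unstable leaf. -/
theorem IsGeometricMarkovPartition.finite_componentClosures [T2Space S] [CompactSpace S]
    (hf : IsPseudoAnosov f Fs Fu) (i k : Fin n) :
    (componentClosures ((R i).inner ∩ f ⁻¹' (R k).inner)).Finite := by
  set W := (R i).inner ∩ f ⁻¹' (R k).inner with hW
  by_contra hinf
  have : Infinite (componentClosures W) := (show (componentClosures W).Infinite from
    hinf).to_subtype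
  have hsecond : SecondCountableTopology S := ChartedSpace.secondCountable_of_sigmaCompact ℂ S
  choose x hx hxe using fun H : componentClosures W => H.2
  have hmem : ∀ H : componentClosures W, closure (connectedComponentIn W (x H)) = H :=
    fun H => (hxe H).symm
  obtain ⟨t, ht, s, hs, hseg⟩ := exists_segment_of_infinite_bands (hR.isSquareParam i)
    (hR.isSquareParam k).swap f (C := fun H : componentClosures W => connectedComponentIn W (x H))
    (fun H => by
      refine isBand_connectedComponentIn (hR.isOpen_horizontal i k) inter_subset_left (hx H) ?_
      rw [hmem]
      exact (hR.horizontal i H (mem_iUnion.2 ⟨k, H.2⟩)).hSaturated (hR.isSquareParam i))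
    (fun H => by
      rw [f.image_connectedComponentIn (hx H)]
      refine isBand_connectedComponentIn ?_ ?_ (mem_image_of_mem f (hx H)) ?_
      · rw [hW, image_inter_preimage]; exact hR.isOpen_vertical i k
      · rw [hW, image_inter_preimage, image_comp_swap_openSquare]; exact inter_subset_right
      · rw [← f.image_connectedComponentIn (hx H), ← f.image_closure, hmem]
        refine (hR.vertical k _ (mem_iUnion.2 ⟨i, ?_⟩)).hSaturated (hR.isSquareParam k)
        rw [componentClosures_image_inter]
        exact mem_image_of_mem _ H.2)
    (fun H H' hne => disjoint_connectedComponentIn_of_ne fun he => hne (Subtype.ext (by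
      rw [← hmem H, ← hmem H', he])))
  obtain ⟨c, hst, hst'⟩ := hf.exists_stretches
  obtain ⟨⟨a, ha⟩, hemb⟩ := (hR.rectangle i).horizontal t ht
  obtain ⟨⟨b, hb⟩, -⟩ := (hR.rectangle k).vertical s hs
  have hsub : ∀ r ∈ Ioo (0 : ℝ) 1, (r, t) ∈ hSegment t := fun r hr =>
    ⟨Ioo_subset_Icc_self hr, rfl⟩
  refine not_injOn_of_mapsTo_leaf hst hst' (J := fun r => f ((R i).param (r, t))) (x := f a)
    (y := b) ?_ ?_ ?_ ?_
  · refine f.continuous.comp_continuousOn ((hR.rectangle i).continuousOn.comp (by fun_prop) ?_)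
    exact fun r hr => ⟨Ioo_subset_Icc_self hr, ht⟩
  · intro r hr
    exact hst.iterate_mem_leaf 1 (ha (mem_image_of_mem _ (hsub r hr)))
  · intro r hr
    have := hseg r hr
    rw [image_comp_swap_hSegment] at this
    exact hb this
  · intro r hr r' hr' he
    have h1 := injOn_iff_injective.2 hemb.injective (hsub r hr) (hsub r' hr') (f.injective he)
    exact congrArg Prod.fst h1

end Partition

/-! ### Geometric types -/

section Types

variable {S : Type*} [TopologicalSpace S] {f : S ≃ₜ S} {n : ℕ} {R : Fin n → GeometricRectangle S}

theorem Set.BijOn.ncard_eq_of_fin {X : Type*} {m : ℕ} {E : Fin m → X} {s : Set X}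
    (h : BijOn E univ s) : m = s.ncard := by
  rw [← h.image_eq, h.injOn.ncard_image, ncard_univ, Nat.card_fin]

/-- The numbers of subrectangles determine the index sets, the sorted enumerations are unique, and
they determine the bijection and the signs. -/
theorem IsGeometricType.unique
    (hH : ∀ i, ∃ κ, Sorts (R i).Below (horizontalSubrectangles f R i) κ)
    (hV : ∀ k, ∃ κ, Sorts (R k).LeftOf (verticalSubrectangles f R k) κ) {T T' : GeometricType}
    (hT : IsGeometricType f R T) (hT' : IsGeometricType f R T') : T = T' := by
  obtain ⟨m, m_pos, a, b, a_pos, b_pos, balance, perm, sign⟩ := T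
  obtain ⟨m', m_pos', a', b', a_pos', b_pos', balance', perm', sign'⟩ := T'
  obtain ⟨(e : m = n), E, V, h1, h2, h3, h4⟩ := hT
  obtain ⟨(e' : m' = n), E', V', h1', h2', h3', h4'⟩ := hT'
  dsimp only at *
  subst e
  subst e'
  obtain rfl : a = a' := funext fun i =>
    (h1 i).1.ncard_eq_of_fin.trans (h1' i).1.ncard_eq_of_fin.symm
  obtain rfl : b = b' := funext fun k =>
    (h2 k).1.ncard_eq_of_fin.trans (h2' k).1.ncard_eq_of_fin.symm
  obtain rfl : E = E' := funext fun i => by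
    obtain ⟨κ, hκ⟩ := hH i
    exact hκ.enumeration_unique (h1 i).1 (h1 i).2 (h1' i).1 (h1' i).2
  obtain rfl : V = V' := funext fun k => by
    obtain ⟨κ, hκ⟩ := hV k
    exact hκ.enumeration_unique (h2 k).1 (h2 k).2 (h2' k).1 (h2' k).2
  obtain rfl : perm = perm' := Equiv.ext fun x => ((h3' x (perm x)).2 ((h3 x _).1 rfl)).symm
  obtain rfl : sign = sign' := funext fun x => by
    have h5 := (h4 x).trans (h4' x).symm
    rcases Int.units_eq_one_or (sign x) with h6 | h6
    · rw [h6, h5.1 h6]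
    · rcases Int.units_eq_one_or (sign' x) with h7 | h7
      · rw [h5.2 h7, h7]
      · rw [h6, h7]
  rfl

theorem IsGeometricMarkovPartition.exists_isGeometricType {S : Type*} [TopologicalSpace S]
    [OrientedSurface S] [T2Space S] [CompactSpace S] [Nonempty S] [LocallyConnectedSpace S]
    {f : S ≃ₜ S} {Fs Fu : MeasuredFoliation S} {n : ℕ} {R : Fin n → GeometricRectangle S}
    (hf : IsPseudoAnosov f Fs Fu) (hR : IsGeometricMarkovPartition f Fs Fu R) :
    ∃ T, IsGeometricType f R T := by
  classical
  have hfinH : ∀ i, (horizontalSubrectangles f R i).Finite := fun i =>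
    finite_iUnion fun k => hR.finite_componentClosures hf i k
  have hfinV : ∀ k, (verticalSubrectangles f R k).Finite := fun k =>
    finite_iUnion fun i => by
      rw [componentClosures_image_inter]
      exact (hR.finite_componentClosures hf i k).image _
  have hne : ∀ i, (R i).inner.Nonempty := fun i =>
    ⟨(R i).param (1 / 2, 1 / 2), _, by constructor <;> constructor <;> norm_num, rfl⟩
  have hneH : ∀ i, (horizontalSubrectangles f R i).Nonempty := fun i => by
    obtain ⟨k, _, ⟨x, hx, rfl⟩, hxk⟩ := hR.exists_inner_inter_nonempty
      (f.isOpenMap _ (hR.isOpen_inner i)) ((hne i).image f)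
    exact ⟨_, mem_iUnion.2 ⟨k, x, ⟨hx, hxk⟩, rfl⟩⟩
  have hneV : ∀ k, (verticalSubrectangles f R k).Nonempty := fun k => by
    obtain ⟨i, x, hxk, hx⟩ := hR.exists_inner_inter_nonempty
      ((hR.isOpen_inner k).preimage f.continuous) ((hne k).preimage f.surjective)
    exact ⟨_, mem_iUnion.2 ⟨i, f x, ⟨mem_image_of_mem f hx, hxk⟩, rfl⟩⟩
  have hn : 0 < n := by
    obtain ⟨x⟩ := ‹Nonempty S›
    obtain ⟨i, -⟩ := mem_iUnion.1 (hR.cover.symm ▸ mem_univ x : x ∈ ⋃ i, (R i).carrier)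
    exact i.pos
  choose κ hκ using hR.exists_sorts_horizontal
  choose ν hν using hR.exists_sorts_vertical
  choose E hE hEB using fun i => (hκ i).exists_enumeration (hfinH i)
  choose V hV hVB using fun k => (hν k).exists_enumeration (hfinV k)
  have hmemE : ∀ a : Σ i, Fin (horizontalSubrectangles f R i).ncard,
      E a.1 a.2 ∈ horizontalSubrectangles f R a.1 := fun a => (hE a.1).mapsTo (mem_univ a.2)
  have hmemV : ∀ b : Σ k, Fin (verticalSubrectangles f R k).ncard,
      V b.1 b.2 ∈ verticalSubrectangles f R b.1 := fun b => (hV b.1).mapsTo (mem_univ b.2)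
  have hidx : ∀ i j, ((R i).inner ∩ (R j).inner).Nonempty → i = j := fun i j hij => by
    by_contra hne
    rw [hR.disjoint i j hne] at hij
    exact not_nonempty_empty hij
  -- A subrectangle determines its label, since different rectangles have disjoint interiors.
  have hinjE : ∀ a a' : Σ i, Fin (horizontalSubrectangles f R i).ncard,
      E a.1 a.2 = E a'.1 a'.2 → a = a' := by
    rintro ⟨i, j⟩ ⟨i', j'⟩ he
    obtain ⟨k, hk⟩ := mem_iUnion.1 (hmemE ⟨i, j⟩)
    obtain ⟨k', hk'⟩ := mem_iUnion.1 (hmemE ⟨i', j'⟩)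
    dsimp only at he hk hk'
    rw [← he] at hk'
    obtain ⟨x, hx, hx'⟩ :=
      inter_nonempty_of_mem_componentClosures (hR.isOpen_horizontal i k) hk hk'
    obtain rfl := hidx i i' ⟨x, hx.1, hx'.1⟩
    rw [(hE i).injOn (mem_univ j) (mem_univ j') he]
  have hinjV : ∀ b b' : Σ k, Fin (verticalSubrectangles f R k).ncard,
      V b.1 b.2 = V b'.1 b'.2 → b = b' := by
    rintro ⟨k, l⟩ ⟨k', l'⟩ he
    obtain ⟨i, hi⟩ := mem_iUnion.1 (hmemV ⟨k, l⟩)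
    obtain ⟨i', hi'⟩ := mem_iUnion.1 (hmemV ⟨k', l'⟩)
    dsimp only at he hi hi'
    rw [← he] at hi'
    obtain ⟨x, hx, hx'⟩ :=
      inter_nonempty_of_mem_componentClosures (hR.isOpen_vertical i k) hi hi'
    obtain rfl := hidx k k' ⟨x, hx.2, hx'.2⟩
    rw [(hV k).injOn (mem_univ l) (mem_univ l') he]
  have hex : ∀ a : Σ i, Fin (horizontalSubrectangles f R i).ncard,
      ∃ b : Σ k, Fin (verticalSubrectangles f R k).ncard, f '' E a.1 a.2 = V b.1 b.2 := by
    intro a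
    obtain ⟨k, hk⟩ := mem_iUnion.1 (hmemE a)
    have h1 : f '' E a.1 a.2 ∈ verticalSubrectangles f R k := mem_iUnion.2 ⟨a.1, by
      rw [componentClosures_image_inter]
      exact mem_image_of_mem _ hk⟩
    obtain ⟨l, -, hl⟩ := (hV k).surjOn h1
    exact ⟨⟨k, l⟩, hl.symm⟩
  choose π hπ using hex
  have hbij : Function.Bijective π := by
    refine ⟨fun a a' he => hinjE a a' (f.injective.image_injective ?_), fun b => ?_⟩
    · rw [hπ, hπ, he]
    · obtain ⟨i, hi⟩ := mem_iUnion.1 (hmemV b)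
      rw [componentClosures_image_inter] at hi
      obtain ⟨H, hH, he⟩ := hi
      obtain ⟨j, -, hj⟩ := (hE i).surjOn (mem_iUnion.2 ⟨b.1, hH⟩)
      refine ⟨⟨i, j⟩, hinjV _ _ ?_⟩
      rw [← hπ, ← he, ← hj]
  let perm := Equiv.ofBijective π hbij
  let T : GeometricType :=
    { n := n
      n_pos := hn
      h := fun i => (horizontalSubrectangles f R i).ncard
      v := fun k => (verticalSubrectangles f R k).ncard
      h_pos := fun i => (ncard_pos (hfinH i)).2 (hneH i)
      v_pos := fun k => (ncard_pos (hfinV k)).2 (hneV k)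
      balance := by simpa using Fintype.card_congr perm
      perm := perm
      sign := fun a => if VerticalDirectionsCoincide f (R a.1) (R (π a).1) (E a.1 a.2)
        then 1 else -1 }
  refine ⟨T, rfl, E, V, fun i => ⟨hE i, hEB i⟩, fun k => ⟨hV k, hVB k⟩, fun a b => ?_,
    fun a => ?_⟩
  · change π a = b ↔ _
    refine ⟨fun h => h ▸ hπ a, fun h => hinjV _ _ ((hπ a).symm.trans h)⟩
  · change (if VerticalDirectionsCoincide f (R a.1) (R (π a).1) (E a.1 a.2)
      then (1 : ℤˣ) else -1) = 1 ↔ VerticalDirectionsCoincide f (R a.1) (R (π a).1) (E a.1 a.2)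
    split_ifs with h
    · exact iff_of_true rfl h
    · exact iff_of_false (by decide) h

end Types

theorem mainTheorem6 {S S' : Type*}
    [TopologicalSpace S] [OrientedSurface S] [T2Space S] [CompactSpace S] [ConnectedSpace S]
    [TopologicalSpace S'] [OrientedSurface S'] [T2Space S'] [CompactSpace S'] [ConnectedSpace S']
    (f : S ≃ₜ S) (Fs Fu : MeasuredFoliation S) (hf : IsPseudoAnosov f Fs Fu)
    (g : S' ≃ₜ S') (Gs Gu : MeasuredFoliation S') (hg : IsPseudoAnosov g Gs Gu)
    (h : S ≃ₜ S') (hh : OrientationPreserving h) (hconj : ∀ x, g x = h (f (h.symm x)))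
    {n : ℕ} (R : Fin n → GeometricRectangle S) (hR : IsGeometricMarkovPartition f Fs Fu R) :
    IsGeometricMarkovPartition g Gs Gu (fun i => (R i).map h) ∧
    ∃ T : GeometricType,
      (∀ T' : GeometricType, IsGeometricType f R T' ↔ T' = T) ∧
      (∀ T' : GeometricType, IsGeometricType g (fun i => (R i).map h) T' ↔ T' = T) := by
  have hloc : LocallyConnectedSpace S := ChartedSpace.locallyConnectedSpace ℂ S
  have hconj₁ : ∀ x, g (h x) = h (f x) := fun x => by rw [hconj, h.symm_apply_apply]
  have hconj₂ : ∀ x, g.symm (h x) = h (f.symm x) := fun x => by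
    rw [g.symm_apply_eq, hconj₁, f.apply_symm_apply]
  obtain ⟨c, hfs, hfu⟩ := hf.exists_stretches
  obtain ⟨c', hgs, hgu⟩ := hg.exists_stretches
  obtain ⟨T, hT⟩ := hR.exists_isGeometricType hf
  have huniq : ∀ T' : GeometricType, IsGeometricType f R T' ↔ T' = T := fun T' =>
    ⟨fun hT' => hT'.unique hR.exists_sorts_horizontal hR.exists_sorts_vertical hT,
      fun he => he ▸ hT⟩
  refine ⟨hR.map hh hconj₁ (hfs.image_leaf_subset hgs hconj₁)
    (hfu.image_leaf_subset hgu hconj₂), T, huniq, fun T' => ?_⟩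
  rw [isGeometricType_map_iff hconj₁, huniq]
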